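/- Let $n\ge 0$ be an integer and $\lambda\in\mathbb R$. Put $\mathcal H=L^2(\mathbb R^n\times\mathbb R^n\times\mathbb R)$ (Lebesgue measure, variables $(x,y,r)$), $e(t)=e^{2\pi i t}$, $\bar e(t)=e^{-2\pi it}$, let $\beta$ be the usual inner product on $\mathbb R^n$, and let $\eta_\lambda(r)=\frac{e^{2\lambda r}-1}{2\lambda}$ for $\lambda\neq0$, $\eta_0(r)=r$. Identify $\mathcal H\otimes\mathcal H$ with $L^2$ in the variables $(x,y,r,x',y',r')$, and let $U_A\in\mathcal B(\mathcal H\otimes\mathcal H)$ be the operator $$U_A\xi(x,y,r,x',y',r')=(e^{-\lambda r'})^n\,\bar e\bigl[\eta_\lambda(r')\beta(e^{-\lambda r'}x,\,y'-e^{-\lambda r'}y)\bigr]\,\xi(e^{-\lambda r'}x,e^{-\lambda r'}y,r+r',x'-e^{-\lambda r'}x,y'-e^{-\lambda r'}y,r').$$ Let $$\hat A=\overline{\{(\mathrm{id}\otimes\omega)(U_A):\omega\in\mathcal B(\mathcal H)_*\}}^{\|\cdot\|}\subseteq\mathcal B(\mathcal H),$$ where $\mathcal B(\mathcal H)_*$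 is the space of normal ($\sigma$-weakly continuous) functionals. Let $\hat{\mathcal A}$ be the space of Schwartz functions in the variables $(x,y,r)$ having compact support in $r$. Then for every $f\in\hat{\mathcal A}$ there is a bounded operator $\rho_f\in\mathcal B(\mathcal H)$ such that for all $\zeta\in\mathcal H$ and almost all $(x,y,r)$ $$(\rho_f\zeta)(x,y,r)=\int_{\mathbb R}(e^{\lambda\tilde r})^n f(x,y,\tilde r)\,\zeta(e^{\lambda\tilde r}x,e^{\lambda\tilde r}y,r-\tilde r)\,d\tilde r,$$ the integrand being integrable in $\tilde r$. The set $\hat A$ is a $C^*$-subalgebra of $\mathcal B(\mathcal H)$, and it is generated by the operators $\rho_f$: it equals the (not necessarily unital) $C^*$-subalgebra of $\mathcal B(\mathcal H)$ generated by $\{\rho_f:f\in\hat{\mathcal A}\}$, and in fact $\hat A=\overline{\{\rho_f:f\in\hat{\mathcal A}\}}^{\|\cdot\|}$. -/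

import Mathlib

open MeasureTheory Filter Topology
open scoped ENNReal SchwartzMap

noncomputable section

namespace QHeis

/-! ### Hilbert spaces, slice maps and normal functionals -/

section General

/-- If `ζ` and `ξ` are square integrable, so is `(a, b) ↦ ζ a * ξ b`, and its norm is the product
of the norms. -/
theorem eLpNorm_tensor {α β : Type*} [MeasurableSpace α] [MeasurableSpace β]
    {μ : Measure α} {ν : Measure β} [SFinite μ] [SFinite ν] {ζ : α → ℂ} {ξ : β → ℂ}
    (hζ : AEStronglyMeasurable ζ μ) (hξ : AEStronglyMeasurable ξ ν) :
    eLpNorm (fun p : α × β => ζ p.1 * ξ p.2) 2 (μ.prod ν) = eLpNorm ζ 2 μ * eLpNorm ξ 2 ν := by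
  simp only [eLpNorm_eq_lintegral_rpow_enorm_toReal two_ne_zero ENNReal.ofNat_ne_top, enorm_mul]
  rw [← ENNReal.mul_rpow_of_nonneg _ _ (by positivity), ← lintegral_prod_mul
    (by fun_prop) (by fun_prop)]
  simp only [ENNReal.toReal_ofNat, ENNReal.mul_rpow_of_nonneg _ _ (zero_le_two (α := ℝ))]

theorem memLp_tensor {α β : Type*} [MeasurableSpace α] [MeasurableSpace β]
    {μ : Measure α} {ν : Measure β} [SFinite μ] [SFinite ν] {ζ : α → ℂ} {ξ : β → ℂ}
    (hζ : MemLp ζ 2 μ) (hξ : MemLp ξ 2 ν) :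
    MemLp (fun p : α × β => ζ p.1 * ξ p.2) 2 (μ.prod ν) := by
  refine ⟨hζ.1.comp_fst.mul hξ.1.comp_snd, ?_⟩
  rw [eLpNorm_tensor hζ.1 hξ.1]
  exact ENNReal.mul_lt_top hζ.2 hξ.2

/-- The bilinear map `(ζ, ξ) ↦ ζ ⊗ ξ`, where `L²(μ) ⊗ L²(ν)` is identified with `L²(μ × ν)`:
`(ζ ⊗ ξ)(a, b) = ζ(a) ξ(b)`. -/
def tensor {α β : Type*} [MeasurableSpace α] [MeasurableSpace β]
    (μ : Measure α) (ν : Measure β) [SFinite μ] [SFinite ν] :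
    Lp ℂ 2 μ →L[ℂ] Lp ℂ 2 ν →L[ℂ] Lp ℂ 2 (μ.prod ν) :=
  LinearMap.mkContinuous₂
    (LinearMap.mk₂ ℂ (fun (ζ : Lp ℂ 2 μ) (ξ : Lp ℂ 2 ν) =>
        (memLp_tensor (Lp.memLp ζ) (Lp.memLp ξ)).toLp _)
      (fun ζ ζ' ξ => by
        rw [← MemLp.toLp_add, MemLp.toLp_eq_toLp_iff]
        filter_upwards [Measure.quasiMeasurePreserving_fst.ae (Lp.coeFn_add ζ ζ')] with p hp
        simp only [Pi.add_apply] at hp ⊢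
        rw [hp]; ring)
      (fun c ζ ξ => by
        rw [← MemLp.toLp_const_smul, MemLp.toLp_eq_toLp_iff]
        filter_upwards [Measure.quasiMeasurePreserving_fst.ae (Lp.coeFn_smul c ζ)] with p hp
        simp only [Pi.smul_apply, smul_eq_mul] at hp ⊢
        rw [hp]; ring)
      (fun ζ ξ ξ' => by
        rw [← MemLp.toLp_add, MemLp.toLp_eq_toLp_iff]
        filter_upwards [Measure.quasiMeasurePreserving_snd.ae (Lp.coeFn_add ξ ξ')] with p hp
        simp only [Pi.add_apply] at hp ⊢
        rw [hp]; ring)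
      (fun c ζ ξ => by
        rw [← MemLp.toLp_const_smul, MemLp.toLp_eq_toLp_iff]
        filter_upwards [Measure.quasiMeasurePreserving_snd.ae (Lp.coeFn_smul c ξ)] with p hp
        simp only [Pi.smul_apply, smul_eq_mul] at hp ⊢
        rw [hp]; ring))
    1 (fun ζ ξ => by
      rw [LinearMap.mk₂_apply, Lp.norm_toLp, eLpNorm_tensor (Lp.aestronglyMeasurable ζ)
        (Lp.aestronglyMeasurable ξ), ENNReal.toReal_mul, one_mul, Lp.norm_def, Lp.norm_def])

theorem tensor_apply {α β : Type*} [MeasurableSpace α] [MeasurableSpace β]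
    (μ : Measure α) (ν : Measure β) [SFinite μ] [SFinite ν] (ζ : Lp ℂ 2 μ) (ξ : Lp ℂ 2 ν) :
    tensor μ ν ζ ξ =ᵐ[μ.prod ν] fun p => ζ p.1 * ξ p.2 :=
  (memLp_tensor (Lp.memLp ζ) (Lp.memLp ξ)).coeFn_toLp

/-- The predual `B(H)_*`, as a set of bounded functionals on `B(H)`: the functionals of the form
`T ↦ ∑ₖ ⟨T ξₖ, ηₖ⟩` with `∑ ‖ξₖ‖² < ∞` and `∑ ‖ηₖ‖² < ∞`, i.e. the σ-weakly continuous ones. -/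
def predual (H : Type*) [NormedAddCommGroup H] [InnerProductSpace ℂ H] :
    Set (StrongDual ℂ (H →L[ℂ] H)) :=
  {ω | ∃ ξ η : ℕ → H, Summable (fun k => ‖ξ k‖ ^ 2) ∧ Summable (fun k => ‖η k‖ ^ 2) ∧
    ∀ T : H →L[ℂ] H, HasSum (fun k => inner ℂ (η k) (T (ξ k))) (ω T)}

/-- The operator `(ω_{ζ,ζ'} ⊗ id)(T)` for `T` on `L²(μ) ⊗ L²(ν)` and the vector functional
`ω_{ζ,ζ'}(S) = ⟨S ζ, ζ'⟩`, that is, the composition `ξ ↦ ζ ⊗ ξ ↦ T (ζ ⊗ ξ)` followed by the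
adjoint of `ξ ↦ ζ' ⊗ ξ`. -/
def vectorSlice {α β : Type*} [MeasurableSpace α] [MeasurableSpace β]
    {μ : Measure α} {ν : Measure β} [SFinite μ] [SFinite ν]
    (T : Lp ℂ 2 (μ.prod ν) →L[ℂ] Lp ℂ 2 (μ.prod ν)) (ζ ζ' : Lp ℂ 2 μ) :
    Lp ℂ 2 ν →L[ℂ] Lp ℂ 2 ν :=
  (ContinuousLinearMap.adjoint (tensor μ ν ζ')) ∘L T ∘L (tensor μ ν ζ)

theorem inner_vectorSlice {α β : Type*} [MeasurableSpace α] [MeasurableSpace β]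
    {μ : Measure α} {ν : Measure β} [SFinite μ] [SFinite ν]
    (T : Lp ℂ 2 (μ.prod ν) →L[ℂ] Lp ℂ 2 (μ.prod ν)) (ζ ζ' : Lp ℂ 2 μ) (ξ η : Lp ℂ 2 ν) :
    inner ℂ η (vectorSlice T ζ ζ' ξ) = inner ℂ (tensor μ ν ζ' η) (T (tensor μ ν ζ ξ)) := by
  simp [vectorSlice, ContinuousLinearMap.adjoint_inner_right]

/-- The bounded sesquilinear form `(ζ', ζ) ↦ ω ((ω_{ζ,ζ'} ⊗ id)(T))`. -/
def sliceForm {α β : Type*} [MeasurableSpace α] [MeasurableSpace β]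
    {μ : Measure α} {ν : Measure β} [SFinite μ] [SFinite ν]
    (ω : StrongDual ℂ (Lp ℂ 2 ν →L[ℂ] Lp ℂ 2 ν))
    (T : Lp ℂ 2 (μ.prod ν) →L[ℂ] Lp ℂ 2 (μ.prod ν)) :
    Lp ℂ 2 μ →L⋆[ℂ] Lp ℂ 2 μ →L[ℂ] ℂ :=
  LinearMap.mkContinuous₂
    (LinearMap.mk₂'ₛₗ (starRingEnd ℂ) (RingHom.id ℂ)
      (fun ζ' ζ => ω (vectorSlice T ζ ζ'))
      (fun a b ζ => by simp [vectorSlice, ContinuousLinearMap.add_comp])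
      (fun c a ζ => by simp [vectorSlice, map_smulₛₗ, ContinuousLinearMap.smul_comp])
      (fun a ζ ζ' => by simp [vectorSlice, ContinuousLinearMap.comp_add])
      (fun c a ζ => by simp [vectorSlice]))
    (‖ω‖ * (‖tensor μ ν‖ * ‖T‖ * ‖tensor μ ν‖)) (fun ζ' ζ => by
      have h1 : ‖vectorSlice T ζ ζ'‖ ≤
          (‖tensor μ ν‖ * ‖ζ'‖) * (‖T‖ * (‖tensor μ ν‖ * ‖ζ‖)) := by
        refine (ContinuousLinearMap.opNorm_comp_le _ _).trans ?_
        have h2 : ‖ContinuousLinearMap.adjoint (tensor μ ν ζ')‖ ≤ ‖tensor μ ν‖ * ‖ζ'‖ := by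
          rw [LinearIsometryEquiv.norm_map]; exact (tensor μ ν).le_opNorm ζ'
        have h3 : ‖T ∘L (tensor μ ν ζ)‖ ≤ ‖T‖ * (‖tensor μ ν‖ * ‖ζ‖) :=
          (ContinuousLinearMap.opNorm_comp_le _ _).trans
            (by gcongr; exact (tensor μ ν).le_opNorm ζ)
        gcongr
      calc ‖ω (vectorSlice T ζ ζ')‖ ≤ ‖ω‖ * ‖vectorSlice T ζ ζ'‖ := ω.le_opNorm _
        _ ≤ ‖ω‖ * ((‖tensor μ ν‖ * ‖ζ'‖) * (‖T‖ * (‖tensor μ ν‖ * ‖ζ‖))) := by gcongr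
        _ = _ := by ring)

/-- The right slice `(id ⊗ ω)(T)`, the unique bounded operator with
`⟨(id ⊗ ω)(T) ζ, ζ'⟩ = ω ((ω_{ζ,ζ'} ⊗ id)(T))`; see `inner_rightSlice`. -/
def rightSlice {α β : Type*} [MeasurableSpace α] [MeasurableSpace β]
    {μ : Measure α} {ν : Measure β} [SFinite μ] [SFinite ν]
    (ω : StrongDual ℂ (Lp ℂ 2 ν →L[ℂ] Lp ℂ 2 ν))
    (T : Lp ℂ 2 (μ.prod ν) →L[ℂ] Lp ℂ 2 (μ.prod ν)) :
    Lp ℂ 2 μ →L[ℂ] Lp ℂ 2 μ :=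
  ContinuousLinearMap.adjoint (InnerProductSpace.continuousLinearMapOfBilin (sliceForm ω T))

theorem inner_rightSlice {α β : Type*} [MeasurableSpace α] [MeasurableSpace β]
    {μ : Measure α} {ν : Measure β} [SFinite μ] [SFinite ν]
    (ω : StrongDual ℂ (Lp ℂ 2 ν →L[ℂ] Lp ℂ 2 ν))
    (T : Lp ℂ 2 (μ.prod ν) →L[ℂ] Lp ℂ 2 (μ.prod ν)) (ζ ζ' : Lp ℂ 2 μ) :
    inner ℂ ζ' (rightSlice ω T ζ) = ω (vectorSlice T ζ ζ') := by
  rw [rightSlice, ContinuousLinearMap.adjoint_inner_right,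
    InnerProductSpace.continuousLinearMapOfBilin_apply]
  rfl

/-- Data for a weighted composition operator `ξ ↦ w · (ξ ∘ T)` that is isometric on `L²`. -/
structure IsWeightedIso {α : Type*} [MeasurableSpace α] (μ : Measure α)
    (w : α → ℂ) (T : α → α) : Prop where
  measurable_weight : Measurable w
  measurable_map : Measurable T
  weight_ne_zero : ∀ p, w p ≠ 0
  lintegral_eq : ∀ g : α → ℝ≥0∞, Measurable g →
    ∫⁻ p, ‖w p‖ₑ ^ (2 : ℝ) * g (T p) ∂μ = ∫⁻ p, g p ∂μ

theorem IsWeightedIso.quasi {α : Type*} [MeasurableSpace α] {μ : Measure α}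
    {w : α → ℂ} {T : α → α} (h : IsWeightedIso μ w T) :
    Measure.QuasiMeasurePreserving T μ μ := by
  refine ⟨h.measurable_map, Measure.AbsolutelyContinuous.mk fun s hs h0 => ?_⟩
  rw [Measure.map_apply h.measurable_map hs]
  have h1 := h.lintegral_eq (s.indicator 1) (measurable_one.indicator hs)
  rw [lintegral_indicator_one hs, h0] at h1
  have hm : Measurable fun p => ‖w p‖ₑ ^ (2 : ℝ) * s.indicator (1 : α → ℝ≥0∞) (T p) :=
    (h.measurable_weight.enorm.pow_const _).mul
      ((measurable_one.indicator hs).comp h.measurable_map)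
  rw [lintegral_eq_zero_iff hm] at h1
  rw [measure_eq_zero_iff_ae_notMem]
  filter_upwards [h1] with p hp hmem
  have h2 : (s.indicator (1 : α → ℝ≥0∞)) (T p) = 1 := by
    simp [Set.indicator_of_mem (show T p ∈ s from hmem)]
  simp [h2, h.weight_ne_zero p] at hp

theorem IsWeightedIso.eLpNorm_eq {α : Type*} [MeasurableSpace α] {μ : Measure α}
    {w : α → ℂ} {T : α → α} (h : IsWeightedIso μ w T) {f : α → ℂ} (hf : StronglyMeasurable f) :
    eLpNorm (fun p => w p * f (T p)) 2 μ = eLpNorm f 2 μ := by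
  simp only [eLpNorm_eq_lintegral_rpow_enorm_toReal two_ne_zero ENNReal.ofNat_ne_top, enorm_mul,
    ENNReal.toReal_ofNat, ENNReal.mul_rpow_of_nonneg _ _ (zero_le_two (α := ℝ))]
  rw [h.lintegral_eq (fun p => ‖f p‖ₑ ^ (2 : ℝ)) (hf.measurable.enorm.pow_const _)]

theorem IsWeightedIso.memLp {α : Type*} [MeasurableSpace α] {μ : Measure α}
    {w : α → ℂ} {T : α → α} (h : IsWeightedIso μ w T) (f : Lp ℂ 2 μ) :
    MemLp (fun p => w p * f (T p)) 2 μ := by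
  refine ⟨(h.measurable_weight.mul
    ((Lp.stronglyMeasurable f).measurable.comp h.measurable_map)).aestronglyMeasurable, ?_⟩
  rw [h.eLpNorm_eq (Lp.stronglyMeasurable f)]
  exact (Lp.memLp f).2

/-- The isometric operator `ξ ↦ w · (ξ ∘ T)` on `L²(μ)`. -/
def weightedIso {α : Type*} [MeasurableSpace α] {μ : Measure α}
    {w : α → ℂ} {T : α → α} (h : IsWeightedIso μ w T) : Lp ℂ 2 μ →ₗᵢ[ℂ] Lp ℂ 2 μ where
  toFun f := (h.memLp f).toLp _
  map_add' f g := by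
    rw [← MemLp.toLp_add, MemLp.toLp_eq_toLp_iff]
    filter_upwards [h.quasi.ae (Lp.coeFn_add f g)] with p hp
    simp only [Pi.add_apply] at hp ⊢
    rw [hp]; ring
  map_smul' c f := by
    rw [RingHom.id_apply, ← MemLp.toLp_const_smul, MemLp.toLp_eq_toLp_iff]
    filter_upwards [h.quasi.ae (Lp.coeFn_smul c f)] with p hp
    simp only [Pi.smul_apply, smul_eq_mul] at hp ⊢
    rw [hp]; ring
  norm_map' f := by
    change ‖(h.memLp f).toLp _‖ = ‖f‖
    rw [Lp.norm_toLp, h.eLpNorm_eq (Lp.stronglyMeasurable f), Lp.norm_def]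

end General

/-! ### The operator `U_A` -/

/-- `ℝⁿ` with its Euclidean structure. -/
abbrev E (n : ℕ) : Type := EuclideanSpace ℝ (Fin n)

/-- The space of the variables `(x, y, r)`, with Lebesgue measure `dx dy dr`. -/
abbrev Pt (n : ℕ) : Type := E n × E n × ℝ

/-- The Hilbert space `ℋ = L²` in the variables `(x, y, r)`. -/
abbrev Hilb (n : ℕ) : Type := Lp ℂ 2 (volume : Measure (Pt n))

/-- `ℋ ⊗ ℋ = L²` in the variables `(x, y, r, x', y', r')`. -/
abbrev Hilb₂ (n : ℕ) : Type :=
  Lp ℂ 2 ((volume : Measure (Pt n)).prod (volume : Measure (Pt n)))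

/-- `η_λ(r) = (e^{2λr} - 1) / (2λ)`, and `η_0(r) = r`. -/
def eta (lam r : ℝ) : ℝ :=
  if lam = 0 then r else (Real.exp (2 * lam * r) - 1) / (2 * lam)

/-- `ē(t) = e^{-2πit}`. -/
def ebar (t : ℝ) : ℂ := Complex.exp (-(2 * Real.pi * t * Complex.I))

/-- The factor `(e^{-λr'})ⁿ ē[η_λ(r') β(e^{-λr'}x, y' - e^{-λr'}y)]` of `U_A`. -/
def uWeight (n : ℕ) (lam : ℝ) : Pt n × Pt n → ℂ := fun ⟨(x, y, _), (_, y', r')⟩ =>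
  ((Real.exp (-lam * r') ^ n : ℝ) : ℂ) *
    ebar (eta lam r' *
      inner ℝ (Real.exp (-lam * r') • x) (y' - Real.exp (-lam * r') • y))

/-- The substitution
`(x, y, r, x', y', r') ↦ (e^{-λr'}x, e^{-λr'}y, r + r', x' - e^{-λr'}x, y' - e^{-λr'}y, r')`. -/
def uMap (n : ℕ) (lam : ℝ) : Pt n × Pt n → Pt n × Pt n := fun ⟨(x, y, r), (x', y', r')⟩ =>
  ((Real.exp (-lam * r') • x, Real.exp (-lam * r') • y, r + r'),
    (x' - Real.exp (-lam * r') • x, y' - Real.exp (-lam * r') • y, r'))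

theorem measurable_eta (lam : ℝ) : Measurable (eta lam) := by
  unfold eta
  split_ifs <;> fun_prop

theorem norm_ebar (t : ℝ) : ‖ebar t‖ = 1 := by
  have : ebar t = Complex.exp (((-(2 * Real.pi * t) : ℝ) : ℂ) * Complex.I) := by
    simp [ebar]
  rw [this, Complex.norm_exp_ofReal_mul_I]

theorem enorm_uWeight (n : ℕ) (lam : ℝ) (p : Pt n × Pt n) :
    ‖uWeight n lam p‖ₑ = ENNReal.ofReal (Real.exp (-lam * p.2.2.2) ^ n) := by
  obtain ⟨⟨x, y, r⟩, ⟨x', y', r'⟩⟩ := p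
  have h : 0 ≤ Real.exp (-lam * r') ^ n := by positivity
  rw [← ofReal_norm]
  congr 1
  simp only [uWeight, norm_mul, norm_ebar, mul_one, Complex.norm_real, Real.norm_of_nonneg h]

theorem lintegral_scale (n : ℕ) {c : ℝ} (hc : 0 < c) (s : ℝ) (k : Pt n → ℝ≥0∞)
    (hk : Measurable k) :
    ENNReal.ofReal (c ^ n) ^ (2 : ℝ) * ∫⁻ a : Pt n, k (c • a.1, c • a.2.1, a.2.2 + s)
      = ∫⁻ a, k a := by
  have hm : Measurable (fun x : E n => c • x) := measurable_const_smul c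
  have hs : Measurable (fun r : ℝ => r + s) := measurable_add_const s
  have h1 : Measure.map (Prod.map (fun x : E n => c • x)
      (Prod.map (fun x : E n => c • x) (fun r : ℝ => r + s))) (volume : Measure (Pt n)) =
      (ENNReal.ofReal (c ^ n)⁻¹ * ENNReal.ofReal (c ^ n)⁻¹) • (volume : Measure (Pt n)) := by
    have hx : Measure.map (fun x : E n => c • x) volume
        = ENNReal.ofReal (c ^ n)⁻¹ • (volume : Measure (E n)) := by
      have := Measure.map_addHaar_smul (volume : Measure (E n)) hc.ne'
      rw [finrank_euclideanSpace_fin, abs_of_pos (by positivity)] at this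
      exact this
    change Measure.map _ (Measure.prod volume (Measure.prod volume volume)) = _
    rw [← Measure.map_prod_map _ _ hm (hm.prodMap hs), ← Measure.map_prod_map _ _ hm hs, hx,
      map_add_right_eq_self, Measure.prod_smul_left, Measure.prod_smul_left,
      Measure.prod_smul_right, smul_smul]
    rfl
  have h2 : ∫⁻ a : Pt n, k (c • a.1, c • a.2.1, a.2.2 + s) =
      ∫⁻ a, k a ∂(Measure.map (Prod.map (fun x : E n => c • x)
      (Prod.map (fun x : E n => c • x) (fun r : ℝ => r + s))) (volume : Measure (Pt n))) := by
    rw [lintegral_map hk (hm.prodMap (hm.prodMap hs))]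
    rfl
  have h3 : ENNReal.ofReal (c ^ n) * ENNReal.ofReal (c ^ n)⁻¹ = 1 := by
    rw [← ENNReal.ofReal_mul (by positivity), mul_inv_cancel₀ (by positivity), ENNReal.ofReal_one]
  rw [h2, h1, lintegral_smul_measure, smul_eq_mul, ← mul_assoc, ENNReal.rpow_two, sq,
    mul_mul_mul_comm, h3, one_mul, one_mul]

theorem measurable_uMap (n : ℕ) (lam : ℝ) : Measurable (uMap n lam) := by
  unfold uMap
  fun_prop

theorem measurable_uWeight (n : ℕ) (lam : ℝ) : Measurable (uWeight n lam) := by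
  have := measurable_eta lam
  unfold uWeight ebar
  fun_prop

theorem isWeightedIso_u (n : ℕ) (lam : ℝ) :
    IsWeightedIso ((volume : Measure (Pt n)).prod (volume : Measure (Pt n)))
      (uWeight n lam) (uMap n lam) where
  measurable_weight := measurable_uWeight n lam
  measurable_map := measurable_uMap n lam
  weight_ne_zero p := by
    rw [← enorm_ne_zero, enorm_uWeight]
    exact (ENNReal.ofReal_pos.2 (by positivity)).ne'
  lintegral_eq g hg := by
    have hmeas : Measurable fun p : Pt n × Pt n =>
        ‖uWeight n lam p‖ₑ ^ (2 : ℝ) * g (uMap n lam p) :=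
      ((measurable_uWeight n lam).enorm.pow_const _).mul (hg.comp (measurable_uMap n lam))
    have hshear : Measurable fun p : Pt n × Pt n =>
        g (p.1, (p.2.1 - p.1.1, p.2.2.1 - p.1.2.1, p.2.2.2)) := hg.comp (by fun_prop)
    rw [lintegral_prod_symm _ hmeas.aemeasurable]
    calc ∫⁻ b : Pt n, ∫⁻ a : Pt n, ‖uWeight n lam (a, b)‖ₑ ^ (2 : ℝ) * g (uMap n lam (a, b))
        = ∫⁻ b : Pt n, ∫⁻ a : Pt n, g (a, (b.1 - a.1, b.2.1 - a.2.1, b.2.2)) := by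
          refine lintegral_congr fun b => ?_
          simp only [enorm_uWeight]
          have hm : Measurable fun a : Pt n => g (uMap n lam (a, b)) :=
            hg.comp ((measurable_uMap n lam).comp (by fun_prop))
          rw [lintegral_const_mul _ hm]
          exact lintegral_scale n (Real.exp_pos (-lam * b.2.2)) b.2.2
            (fun a => g (a, (b.1 - a.1, b.2.1 - a.2.1, b.2.2))) (hg.comp (by fun_prop))
      _ = ∫⁻ a : Pt n, ∫⁻ b : Pt n, g (a, (b.1 - a.1, b.2.1 - a.2.1, b.2.2)) :=
          lintegral_lintegral_swap (hshear.comp measurable_swap).aemeasurable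
      _ = ∫⁻ a : Pt n, ∫⁻ b : Pt n, g (a, b) := by
          refine lintegral_congr fun a => ?_
          have hmp : MeasurePreserving (Prod.map (fun x : E n => x - a.1)
              (Prod.map (fun y : E n => y - a.2.1) (id : ℝ → ℝ)))
              (volume : Measure (Pt n)) volume :=
            (measurePreserving_sub_right volume a.1).prod
              ((measurePreserving_sub_right volume a.2.1).prod (MeasurePreserving.id volume))
          exact hmp.lintegral_comp (f := fun b => g (a, b)) (hg.comp (by fun_prop))
      _ = _ := (lintegral_prod _ hg.aemeasurable).symm

/-- The fundamental operator `U_A` on `ℋ ⊗ ℋ`: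
`U_A ξ(x, y, r, x', y', r') = (e^{-λr'})ⁿ ē[η_λ(r') β(e^{-λr'}x, y' - e^{-λr'}y)]`
`ξ(e^{-λr'}x, e^{-λr'}y, r + r', x' - e^{-λr'}x, y' - e^{-λr'}y, r')`. -/
def UA (n : ℕ) (lam : ℝ) : Hilb₂ n →L[ℂ] Hilb₂ n :=
  (weightedIso (isWeightedIso_u n lam)).toContinuousLinearMap

theorem UA_apply (n : ℕ) (lam : ℝ) (ξ : Hilb₂ n) :
    UA n lam ξ =ᵐ[volume.prod volume] fun p => uWeight n lam p * ξ (uMap n lam p) :=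
  ((isWeightedIso_u n lam).memLp ξ).coeFn_toLp

/-- `U_A ξ` in coordinates. -/
theorem UA_apply_coord (n : ℕ) (lam : ℝ) (ξ : Hilb₂ n) :
    ∀ᵐ p ∂((volume : Measure (Pt n)).prod (volume : Measure (Pt n))),
      ∀ x y r x' y' r', p = ((x, y, r), (x', y', r')) →
      UA n lam ξ ((x, y, r), (x', y', r')) =
        ((Real.exp (-lam * r') ^ n : ℝ) : ℂ) *
          ebar (eta lam r' *
            inner ℝ (Real.exp (-lam * r') • x) (y' - Real.exp (-lam * r') • y)) *
          ξ ((Real.exp (-lam * r') • x, Real.exp (-lam * r') • y, r + r'),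
            (x' - Real.exp (-lam * r') • x, y' - Real.exp (-lam * r') • y, r')) := by
  filter_upwards [UA_apply n lam ξ] with p hp
  rintro x y r x' y' r' rfl
  exact hp

/-! ### The algebra `Â` and the functions defining it -/

/-- `Â`: the norm closure of the set of right slices `(id ⊗ ω)(U_A)`, `ω ∈ B(ℋ)_*`. -/
def hatA (n : ℕ) (lam : ℝ) : Set (Hilb n →L[ℂ] Hilb n) :=
  closure {S | ∃ ω ∈ predual (Hilb n), S = rightSlice ω (UA n lam)}

/-- Schwartz functions in the variables `(x, y, r)` with compact support in the variable `r`. -/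
def hatA₀ (n : ℕ) : Set (𝓢(Pt n, ℂ)) :=
  {f | ∃ K : Set ℝ, IsCompact K ∧ ∀ x y r, r ∉ K → f (x, y, r) = 0}

/-- The integrand (as a function of `t = r̃`) in the definition of `(ρ_f ζ)(x, y, r)`. -/
def rhoIntegrand (n : ℕ) (lam : ℝ) (f : 𝓢(Pt n, ℂ)) (ζ : Hilb n) (p : Pt n) (t : ℝ) : ℂ :=
  ((Real.exp (lam * t) ^ n : ℝ) : ℂ) * f (p.1, p.2.1, t) *
    ζ (Real.exp (lam * t) • p.1, Real.exp (lam * t) • p.2.1, p.2.2 - t)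

end QHeis

end

noncomputable section

namespace QHeis

variable {n : ℕ} {lam : ℝ}

/-! ### The flow and the integral operators attached to symbols -/

/-! The operators `V_t ζ = (e^{λt})ⁿ ζ ∘ flow_t` form a one-parameter unitary group, because the
Jacobian of `flow_t` is `e^{2nλt}` (both `x` and `y` are dilated). Hence `ρ_f = ∫ f(x, y, t) V_t dt`
is the integrated form of a covariant pair: multiplication by functions of `(x, y)`, and `V`, which
implements dilations. Its norm is at most `2RC` when `|f| ≤ C` and `f` vanishes for `|r| > R`
(`norm_rhoOp_le`), so uniform approximation of symbols with controlled `r`-support becomes norm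
approximation of operators (`rhoOp_mem_closure`).

Products and adjoints of such operators come from a twisted convolution and an involution of symbols
(`rhoOp_mul`, `star_rhoOp`), both of which preserve `C_c`. The operators with `C_c` symbols thus
form a `*`-algebra. Cutoffs and mollification show that it has the same norm closure as the
operators with symbols in `hatA₀ n`, and this closure is the bridge to `Â`.

On the other side, slicing `U_A` by a vector functional `ω_{ξ,η}` with `ξ, η ∈ C_c` and putting `r'
= -t` gives exactly a `ρ_f`, whose symbol is an explicit twisted correlation of `ξ` and `η`
(`vecSlice_eq_rhoOp`). Normal functionals are absolutely convergent series of vector functionals,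
and `C_c` is dense in `L²`, so `Â` lies in the closure above. Conversely, taking `ξ` to be an
approximate identity in `(x, y)` makes these correlations uniformly dense
(`exists_sliceFun_approx`), which gives equality. -/

/-- The flow `(x, y, r) ↦ (e^{λt}x, e^{λt}y, r - t)`. -/
def flow (lam t : ℝ) (p : Pt n) : Pt n :=
  (Real.exp (lam * t) • p.1, Real.exp (lam * t) • p.2.1, p.2.2 - t)

theorem continuous_flow (lam : ℝ) : Continuous fun z : Pt n × ℝ => flow lam z.2 z.1 := by
  unfold flow
  fun_prop

theorem flow_flow (lam s t : ℝ) (p : Pt n) : flow lam s (flow lam t p) = flow lam (t + s) p := by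
  simp only [flow, smul_smul, ← Real.exp_add, sub_sub, ← mul_add, add_comm t s]

/-- The square of the weight is the Jacobian of the flow, so each weighted translate is isometric on
`L²`. -/
theorem lintegral_flow (lam t : ℝ) {k : Pt n → ℝ≥0∞} (hk : Measurable k) :
    ENNReal.ofReal (Real.exp (lam * t) ^ n) ^ 2 * ∫⁻ a : Pt n, k (flow lam t a) = ∫⁻ a, k a := by
  have := lintegral_scale n (Real.exp_pos (lam * t)) (-t) k hk
  rw [ENNReal.rpow_two] at this
  simpa only [flow, sub_eq_add_neg] using this

/-- The operators sample an `L²` class along orbits, which are null sets in general. Joint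
nonsingularity in `(p, t)` makes this independent of the representative: each time slice of the
preimage of a null set is null, and Tonelli applies. -/
theorem quasiMeasurePreserving_flow (n : ℕ) (lam : ℝ) :
    Measure.QuasiMeasurePreserving (fun z : Pt n × ℝ => flow lam z.2 z.1)
      ((volume : Measure (Pt n)).prod volume) volume := by
  have hm : Measurable fun z : Pt n × ℝ => flow lam z.2 z.1 := (continuous_flow lam).measurable
  refine ⟨hm, Measure.AbsolutelyContinuous.mk fun s hs h0 => ?_⟩
  rw [Measure.map_apply hm hs, Measure.prod_apply_symm (hm hs)]
  refine (lintegral_congr fun t => ?_).trans lintegral_zero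
  have h1 := lintegral_flow lam t (n := n) (k := s.indicator 1) (measurable_one.indicator hs)
  rw [lintegral_indicator_one hs, h0, mul_eq_zero] at h1
  have h2 : ENNReal.ofReal (Real.exp (lam * t) ^ n) ^ 2 ≠ 0 :=
    pow_ne_zero _ (ENNReal.ofReal_pos.2 (by positivity)).ne'
  have h3 := h1.resolve_left h2
  exact (lintegral_indicator_one ((hm.comp measurable_prodMk_right) hs)).symm.trans h3

theorem ae_ae_flow {P : Pt n → Prop} (h : ∀ᵐ q, P q) (lam : ℝ) :
    ∀ᵐ p : Pt n, ∀ᵐ t : ℝ, P (flow lam t p) :=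
  Measure.ae_ae_of_ae_prod ((quasiMeasurePreserving_flow n lam).ae h)

theorem sq_lintegral_le {α : Type*} [MeasurableSpace α] (μ : Measure α) {g : α → ℝ≥0∞}
    (hg : Measurable g) : (∫⁻ a, g a ∂μ) ^ 2 ≤ μ Set.univ * ∫⁻ a, g a ^ 2 ∂μ := by
  have h := ENNReal.lintegral_mul_le_Lp_mul_Lq μ Real.HolderConjugate.two_two
    (aemeasurable_const (b := (1 : ℝ≥0∞))) hg.aemeasurable
  simp only [Pi.mul_apply, one_mul, lintegral_const, ENNReal.rpow_two, one_pow] at h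
  have h2 := pow_le_pow_left' h 2
  have h3 : ∀ x : ℝ≥0∞, (x ^ (1 / 2 : ℝ)) ^ 2 = x := fun x => by
    rw [← ENNReal.rpow_two, ← ENNReal.rpow_mul, one_div, inv_mul_cancel₀ two_ne_zero,
      ENNReal.rpow_one]
  rwa [mul_pow, h3, h3] at h2

/-- `f` is continuous, bounded by `C` and vanishes for `|r| > R`. -/
structure SymbolBound (f : Pt n → ℂ) (C R : ℝ) : Prop where
  continuous : Continuous f
  norm_le : ∀ p, ‖f p‖ ≤ C
  nonneg : 0 ≤ R
  eq_zero : ∀ p, R < |p.2.2| → f p = 0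

theorem SymbolBound.const_nonneg {f : Pt n → ℂ} {C R : ℝ} (h : SymbolBound f C R) : 0 ≤ C :=
  (norm_nonneg _).trans (h.norm_le 0)

/-- Bounded continuous functions with compact support in `r`. -/
def IsSymbol (f : Pt n → ℂ) : Prop := ∃ C R, SymbolBound f C R

/-- The integrand of the operator `ρ_f`. -/
def kernelIntegrand (lam : ℝ) (f ζ : Pt n → ℂ) (p : Pt n) (t : ℝ) : ℂ :=
  ((Real.exp (lam * t) ^ n : ℝ) : ℂ) * f (p.1, p.2.1, t) * ζ (flow lam t p)

theorem measurable_kernelIntegrand {f ζ : Pt n → ℂ} (hf : Continuous f) (hζ : Measurable ζ) :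
    Measurable fun z : Pt n × ℝ => kernelIntegrand lam f ζ z.1 z.2 := by
  unfold kernelIntegrand
  have h1 : Measurable fun z : Pt n × ℝ => f (z.1.1, z.1.2.1, z.2) :=
    hf.measurable.comp (by fun_prop)
  have h2 := hζ.comp (continuous_flow (n := n) lam).measurable
  exact (Measurable.mul (by fun_prop) h1).mul h2

/-- Cauchy–Schwarz on `[-R, R]` gives one factor `2R`. After Tonelli every time slice has the same
norm as `ζ`, and integrating over `t` gives the other `2R`. -/
theorem lintegral_kernelIntegrand_sq_le {f ζ : Pt n → ℂ} {C R : ℝ} (hf : SymbolBound f C R)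
    (hζ : Measurable ζ) :
    ∫⁻ p, (∫⁻ t, ‖kernelIntegrand lam f ζ p t‖ₑ) ^ 2 ≤
      ENNReal.ofReal (2 * R * C) ^ 2 * ∫⁻ p, ‖ζ p‖ₑ ^ 2 := by
  set I : Set ℝ := Set.Icc (-R) R with hI
  set g : Pt n → ℝ → ℝ≥0∞ := fun p t =>
    ENNReal.ofReal (Real.exp (lam * t) ^ n) * ‖ζ (flow lam t p)‖ₑ with hg
  have hgm : Measurable fun z : Pt n × ℝ => g z.1 z.2 :=
    Measurable.mul (by fun_prop) (hζ.comp (continuous_flow lam).measurable).enorm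
  have h1 : ∀ p, ∫⁻ t, ‖kernelIntegrand lam f ζ p t‖ₑ ≤ ENNReal.ofReal C * ∫⁻ t in I, g p t := by
    intro p
    have hgp : Measurable (g p) := hgm.comp measurable_prodMk_left
    rw [← lintegral_const_mul _ hgp, ← lintegral_indicator measurableSet_Icc]
    refine lintegral_mono fun t => ?_
    by_cases ht : t ∈ I
    · rw [Set.indicator_of_mem ht, kernelIntegrand, enorm_mul, enorm_mul, mul_comm ‖_‖ₑ ‖f _‖ₑ,
        mul_assoc]
      refine mul_le_mul' ?_ (le_of_eq ?_)
      · rw [← ofReal_norm]; exact ENNReal.ofReal_le_ofReal (hf.norm_le _)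
      · simp only [hg]
        rw [← ofReal_norm (E := ℂ) ((Real.exp (lam * t) ^ n : ℝ) : ℂ), Complex.norm_real,
          Real.norm_of_nonneg (by positivity)]
    · have h0 : f (p.1, p.2.1, t) = 0 :=
        hf.eq_zero _ (by rw [hI, Set.mem_Icc, ← abs_le, not_le] at ht; exact ht)
      simp [kernelIntegrand, h0]
  have hvol : (volume.restrict I) Set.univ = ENNReal.ofReal (2 * R) := by
    rw [Measure.restrict_apply_univ, Real.volume_Icc]; congr 1; ring
  have h2 : ∀ p, (∫⁻ t, ‖kernelIntegrand lam f ζ p t‖ₑ) ^ 2 ≤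
      ENNReal.ofReal C ^ 2 * ENNReal.ofReal (2 * R) * ∫⁻ t in I, g p t ^ 2 := by
    intro p
    refine (pow_le_pow_left' (h1 p) 2).trans ?_
    rw [mul_pow, mul_assoc, ← hvol]
    gcongr
    exact sq_lintegral_le _ (hgm.comp measurable_prodMk_left)
  refine (lintegral_mono h2).trans ?_
  have hgm2 : Measurable fun z : Pt n × ℝ => g z.1 z.2 ^ 2 := hgm.pow_const 2
  rw [lintegral_const_mul _ hgm2.lintegral_prod_right',
    lintegral_lintegral_swap hgm2.aemeasurable]
  have h3 : ∀ t, ∫⁻ p, g p t ^ 2 = ∫⁻ p, ‖ζ p‖ₑ ^ 2 := by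
    intro t
    simp only [hg, mul_pow]
    rw [← lintegral_flow lam t (hζ.enorm.pow_const 2), lintegral_const_mul]
    exact ((hζ.enorm.pow_const 2).comp
      ((continuous_flow lam).measurable.comp measurable_prodMk_right))
  simp only [h3, lintegral_const, hvol]
  rw [ENNReal.ofReal_mul (p := 2 * R) (by linarith [hf.nonneg])]
  exact le_of_eq (by ring)

theorem eLpNorm_two_sq {α F : Type*} [MeasurableSpace α] [NormedAddCommGroup F] {μ : Measure α}
    (f : α → F) :
    eLpNorm f 2 μ ^ 2 = ∫⁻ a, ‖f a‖ₑ ^ 2 ∂μ := by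
  rw [eLpNorm_eq_lintegral_rpow_enorm_toReal two_ne_zero ENNReal.ofNat_ne_top,
    ← ENNReal.rpow_two, ← ENNReal.rpow_mul]
  simp

theorem ae_integrable_kernelIntegrand {f : Pt n → ℂ} (hf : IsSymbol f) (ζ : Hilb n) :
    ∀ᵐ p, Integrable (kernelIntegrand lam f ζ p) := by
  obtain ⟨C, R, hf⟩ := hf
  have hζ := (Lp.stronglyMeasurable ζ).measurable
  have hm := measurable_kernelIntegrand (lam := lam) hf.continuous hζ
  have hfin : ∫⁻ p, (∫⁻ t, ‖kernelIntegrand lam f ζ p t‖ₑ) ^ 2 ≠ ∞ := by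
    refine ((lintegral_kernelIntegrand_sq_le hf hζ).trans_lt ?_).ne
    rw [← eLpNorm_two_sq]
    exact ENNReal.mul_lt_top (by finiteness) (ENNReal.pow_lt_top (Lp.memLp ζ).2)
  filter_upwards [ae_lt_top (hm.enorm.lintegral_prod_right'.pow_const 2) hfin] with p hp
  refine ⟨(hm.comp measurable_prodMk_left).aestronglyMeasurable, ?_⟩
  by_contra h
  rw [HasFiniteIntegral, not_lt, top_le_iff] at h
  simp [h] at hp

theorem eLpNorm_integral_kernelIntegrand_le {f ζ : Pt n → ℂ} {C R : ℝ} (hf : SymbolBound f C R)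
    (hζ : Measurable ζ) :
    eLpNorm (fun p => ∫ t, kernelIntegrand lam f ζ p t) 2 volume ≤
      ENNReal.ofReal (2 * R * C) * eLpNorm ζ 2 volume := by
  have : eLpNorm (fun p => ∫ t, kernelIntegrand lam f ζ p t) 2 volume ^ 2 ≤
      (ENNReal.ofReal (2 * R * C) * eLpNorm ζ 2 volume) ^ 2 := by
    rw [mul_pow, eLpNorm_two_sq, eLpNorm_two_sq]
    refine le_trans (lintegral_mono fun p => ?_) (lintegral_kernelIntegrand_sq_le (lam := lam) hf hζ)
    gcongr
    exact enorm_integral_le_lintegral_enorm _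
  exact (ENNReal.pow_le_pow_left_iff two_ne_zero).1 this

theorem memLp_integral_kernelIntegrand {f : Pt n → ℂ} (hf : IsSymbol f) (ζ : Hilb n) :
    MemLp (fun p => ∫ t, kernelIntegrand lam f ζ p t) 2 volume := by
  obtain ⟨C, R, hf⟩ := hf
  have hζ := (Lp.stronglyMeasurable ζ).measurable
  refine ⟨((measurable_kernelIntegrand (lam := lam) hf.continuous
    hζ).stronglyMeasurable.integral_prod_right').aestronglyMeasurable, ?_⟩
  exact (eLpNorm_integral_kernelIntegrand_le hf hζ).trans_lt
    (ENNReal.mul_lt_top ENNReal.ofReal_lt_top (Lp.memLp ζ).2)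

theorem norm_toLp_integral_kernelIntegrand_le {f : Pt n → ℂ} {C R : ℝ} (hf : SymbolBound f C R)
    (ζ : Hilb n) :
    ‖(memLp_integral_kernelIntegrand (lam := lam) ⟨C, R, hf⟩ ζ).toLp‖ ≤ 2 * R * C * ‖ζ‖ := by
  have h0 : 0 ≤ 2 * R * C := mul_nonneg (by linarith [hf.nonneg]) hf.const_nonneg
  rw [Lp.norm_toLp, Lp.norm_def, ← ENNReal.toReal_ofReal h0, ← ENNReal.toReal_mul]
  refine ENNReal.toReal_mono (ENNReal.mul_lt_top ENNReal.ofReal_lt_top (Lp.memLp ζ).2).ne ?_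
  exact eLpNorm_integral_kernelIntegrand_le hf (Lp.stronglyMeasurable ζ).measurable

/-- The linear map `ζ ↦ ∫ w_t f ζ(flow_t) dt`. -/
def symbolLin (lam : ℝ) {f : Pt n → ℂ} (hf : IsSymbol f) : Hilb n →ₗ[ℂ] Hilb n where
  toFun ζ := (memLp_integral_kernelIntegrand (lam := lam) hf ζ).toLp _
  map_add' ζ ζ' := by
    rw [← MemLp.toLp_add, MemLp.toLp_eq_toLp_iff]
    filter_upwards [ae_ae_flow (Lp.coeFn_add ζ ζ') lam, ae_integrable_kernelIntegrand hf ζ,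
      ae_integrable_kernelIntegrand hf ζ'] with p hp h1 h2
    simp only [Pi.add_apply] at hp ⊢
    rw [← integral_add h1 h2]
    refine integral_congr_ae ?_
    filter_upwards [hp] with t ht
    simp only [kernelIntegrand, ht]; ring
  map_smul' c ζ := by
    rw [RingHom.id_apply, ← MemLp.toLp_const_smul, MemLp.toLp_eq_toLp_iff]
    filter_upwards [ae_ae_flow (Lp.coeFn_smul c ζ) lam] with p hp
    simp only [Pi.smul_apply, smul_eq_mul] at hp ⊢
    rw [← integral_const_mul]
    refine integral_congr_ae ?_
    filter_upwards [hp] with t ht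
    simp only [kernelIntegrand, ht]; ring

open Classical in
/-- The operator `ρ_f` of a symbol `f` (and `0` if `f` is not a symbol). -/
def rhoOp (lam : ℝ) (f : Pt n → ℂ) : Hilb n →L[ℂ] Hilb n :=
  if hf : IsSymbol f then
    (symbolLin lam hf).mkContinuous (2 * hf.choose_spec.choose * hf.choose)
      (norm_toLp_integral_kernelIntegrand_le hf.choose_spec.choose_spec)
  else 0

theorem rhoOp_apply {f : Pt n → ℂ} (hf : IsSymbol f) (ζ : Hilb n) :
    rhoOp lam f ζ =ᵐ[volume] fun p => ∫ t, kernelIntegrand lam f ζ p t := by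
  rw [rhoOp, dif_pos hf]
  exact (memLp_integral_kernelIntegrand hf ζ).coeFn_toLp

/-- The bound holds for every admissible pair `(C, R)`, not only for the pair chosen in the
definition of `rhoOp`. -/
theorem norm_rhoOp_le {f : Pt n → ℂ} {C R : ℝ} (hf : SymbolBound f C R) :
    ‖rhoOp lam f‖ ≤ 2 * R * C := by
  refine ContinuousLinearMap.opNorm_le_bound _
    (mul_nonneg (by linarith [hf.nonneg]) hf.const_nonneg) fun ζ => ?_
  rw [rhoOp, dif_pos ⟨C, R, hf⟩]
  exact norm_toLp_integral_kernelIntegrand_le hf ζ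

theorem IsSymbol.add {f g : Pt n → ℂ} (hf : IsSymbol f) (hg : IsSymbol g) : IsSymbol (f + g) := by
  obtain ⟨C, R, hf⟩ := hf
  obtain ⟨C', R', hg⟩ := hg
  refine ⟨C + C', max R R', hf.continuous.add hg.continuous, fun p => ?_,
    hf.nonneg.trans (le_max_left _ _), fun p hp => ?_⟩
  · exact (norm_add_le _ _).trans (add_le_add (hf.norm_le p) (hg.norm_le p))
  · rw [Pi.add_apply, hf.eq_zero p ((le_max_left _ _).trans_lt hp),
      hg.eq_zero p ((le_max_right _ _).trans_lt hp), add_zero]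

theorem IsSymbol.const_smul {f : Pt n → ℂ} (hf : IsSymbol f) (c : ℂ) : IsSymbol (c • f) := by
  obtain ⟨C, R, hf⟩ := hf
  refine ⟨‖c‖ * C, R, hf.continuous.const_smul c, fun p => ?_, hf.nonneg, fun p hp => ?_⟩
  · rw [Pi.smul_apply, norm_smul]
    exact mul_le_mul_of_nonneg_left (hf.norm_le p) (norm_nonneg _)
  · rw [Pi.smul_apply, hf.eq_zero p hp, smul_zero]

theorem rhoOp_add {f g : Pt n → ℂ} (hf : IsSymbol f) (hg : IsSymbol g) :
    rhoOp lam (f + g) = rhoOp lam f + rhoOp lam g := by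
  refine ContinuousLinearMap.ext fun ζ => Lp.ext ?_
  rw [add_apply]
  filter_upwards [rhoOp_apply (lam := lam) (hf.add hg) ζ, rhoOp_apply (lam := lam) hf ζ,
    rhoOp_apply (lam := lam) hg ζ, Lp.coeFn_add (rhoOp lam f ζ) (rhoOp lam g ζ),
    ae_integrable_kernelIntegrand (lam := lam) hf ζ,
    ae_integrable_kernelIntegrand (lam := lam) hg ζ] with p h1 h2 h3 h4 h5 h6
  rw [h4, Pi.add_apply, h1, h2, h3, ← integral_add h5 h6]
  refine integral_congr_ae (.of_forall fun t => ?_)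
  simp only [kernelIntegrand, Pi.add_apply]; ring

theorem rhoOp_smul {f : Pt n → ℂ} (hf : IsSymbol f) (c : ℂ) :
    rhoOp lam (c • f) = c • rhoOp lam f := by
  refine ContinuousLinearMap.ext fun ζ => Lp.ext ?_
  rw [smul_apply]
  filter_upwards [rhoOp_apply (lam := lam) (hf.const_smul c) ζ, rhoOp_apply (lam := lam) hf ζ,
    Lp.coeFn_smul c (rhoOp lam f ζ)] with p h1 h2 h3
  rw [h3, Pi.smul_apply, h1, h2, ← integral_smul]
  refine integral_congr_ae (.of_forall fun t => ?_)
  simp only [kernelIntegrand, Pi.smul_apply, smul_eq_mul]; ring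

theorem norm_rhoOp_sub_le {f g : Pt n → ℂ} (hg : IsSymbol g) {C R : ℝ}
    (h : SymbolBound (f - g) C R) : ‖rhoOp lam f - rhoOp lam g‖ ≤ 2 * R * C := by
  have h1 : rhoOp lam f = rhoOp lam (f - g) + rhoOp lam g := by
    rw [← rhoOp_add ⟨C, R, h⟩ hg, sub_add_cancel]
  rw [h1, add_sub_cancel_right]
  exact norm_rhoOp_le h

theorem isSymbol_of_hasCompactSupport {f : Pt n → ℂ} (hf : Continuous f)
    (hc : HasCompactSupport f) : IsSymbol f := by
  obtain ⟨C, hC⟩ := hf.bounded_above_of_compact_support hc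
  obtain ⟨R, hR⟩ := hc.isCompact.isBounded.exists_norm_le
  refine ⟨C, max R 0, hf, hC, le_max_right _ _, fun p hp => ?_⟩
  by_contra h
  have h1 := hR p (subset_tsupport f h)
  have h2 : ‖p.2.2‖ ≤ ‖p‖ := (norm_snd_le p.2).trans (norm_snd_le p)
  rw [Real.norm_eq_abs] at h2
  exact absurd hp (not_lt.2 ((h2.trans h1).trans (le_max_left _ _)))

/-! ### The twisted convolution product -/

/-- The twisted convolution `(f * g)(x, y, r) = ∫ f(x, y, t) g(e^{λt}x, e^{λt}y, r - t) dt`. -/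
def twistedConv (lam : ℝ) (f g : Pt n → ℂ) (p : Pt n) : ℂ :=
  ∫ t, f (p.1, p.2.1, t) * g (flow lam t p)

/-- The support of `f` confines `t` to `[-R, R]`, an interval of length `2R`; continuity is then
that of a parametric integral over a compact set. If also `|r| > R + R'`, then `|r - t| > R'`, which
kills `g`. -/
theorem twistedConv_symbolBound {f g : Pt n → ℂ} {C R C' R' : ℝ} (hf : SymbolBound f C R)
    (hg : SymbolBound g C' R') :
    SymbolBound (twistedConv lam f g) (C * C' * (2 * R)) (R + R') := by
  have h0 : ∀ (p : Pt n), ∀ t ∉ Set.Icc (-R) R, f (p.1, p.2.1, t) * g (flow lam t p) = 0 := by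
    intro p t ht
    rw [Set.mem_Icc, ← abs_le, not_le] at ht
    rw [hf.eq_zero _ ht, zero_mul]
  have h1 : ∀ p, twistedConv lam f g p =
      ∫ t in Set.Icc (-R) R, f (p.1, p.2.1, t) * g (flow lam t p) := fun p =>
    (setIntegral_eq_integral_of_forall_compl_eq_zero (h0 p)).symm
  refine ⟨?_, fun p => ?_, add_nonneg hf.nonneg hg.nonneg, fun p hp => ?_⟩
  · rw [funext h1]
    refine continuous_parametric_integral_of_continuous ?_ isCompact_Icc
    exact (hf.continuous.comp (by fun_prop)).mul (hg.continuous.comp (continuous_flow lam))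
  · rw [h1]
    have h2 : (volume : Measure ℝ).real (Set.Icc (-R) R) = 2 * R := by
      rw [Real.volume_real_Icc_of_le (by linarith [hf.nonneg])]; ring
    rw [← h2]
    refine norm_setIntegral_le_of_norm_le_const measure_Icc_lt_top fun t _ => ?_
    rw [norm_mul]
    exact mul_le_mul (hf.norm_le _) (hg.norm_le _) (norm_nonneg _) hf.const_nonneg
  · rw [h1]
    refine setIntegral_eq_zero_of_forall_eq_zero fun t ht => ?_
    rw [Set.mem_Icc, ← abs_le] at ht
    rw [hg.eq_zero (flow lam t p), mul_zero]
    have := abs_sub_abs_le_abs_sub p.2.2 t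
    change R' < |p.2.2 - t|
    linarith

theorem IsSymbol.twistedConv {f g : Pt n → ℂ} (hf : IsSymbol f) (hg : IsSymbol g) :
    IsSymbol (twistedConv lam f g) := by
  obtain ⟨C, R, hf⟩ := hf
  obtain ⟨C', R', hg⟩ := hg
  exact ⟨_, _, twistedConv_symbolBound hf hg⟩

/-- The first factor alone controls `(x, y)`, so the second need only be a symbol. -/
theorem hasCompactSupport_twistedConv {f g : Pt n → ℂ} (hf : Continuous f)
    (hfc : HasCompactSupport f) (hg : IsSymbol g) :
    HasCompactSupport (twistedConv lam f g) := by
  obtain ⟨C, R, hfb⟩ := isSymbol_of_hasCompactSupport hf hfc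
  obtain ⟨C', R', hg⟩ := hg
  have hb := twistedConv_symbolBound (lam := lam) hfb hg
  have hK : IsCompact ((Prod.fst '' tsupport f) ×ˢ ((fun p : Pt n => p.2.1) '' tsupport f) ×ˢ
      Set.Icc (-(R + R')) (R + R')) :=
    (hfc.isCompact.image continuous_fst).prod
      ((hfc.isCompact.image (by fun_prop)).prod isCompact_Icc)
  refine HasCompactSupport.intro hK fun p hp => ?_
  by_contra h
  refine hp ?_
  have hr : |p.2.2| ≤ R + R' := by
    by_contra hr
    exact h (hb.eq_zero p (not_le.1 hr))
  have : ∃ t, f (p.1, p.2.1, t) ≠ 0 := by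
    by_contra! hz
    exact h (by simp [twistedConv, hz])
  obtain ⟨t, ht⟩ := this
  have hmem := subset_tsupport f ht
  exact ⟨⟨_, hmem, rfl⟩, ⟨_, hmem, rfl⟩, abs_le.1 hr⟩

/-- A continuous cutoff in the variable `r`. -/
theorem exists_symbol_one_le (n : ℕ) (S : ℝ) :
    ∃ χ : Pt n → ℂ, IsSymbol χ ∧ ∀ p, |p.2.2| ≤ S → 1 ≤ ‖χ p‖ := by
  refine ⟨fun p => ((max 0 (S + 1 - |p.2.2|) : ℝ) : ℂ), ⟨|S| + 1, |S| + 1, ?_, fun p => ?_,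
    by positivity, fun p hp => ?_⟩, fun p hp => ?_⟩
  · fun_prop
  · rw [Complex.norm_real, Real.norm_of_nonneg (le_max_left _ _)]
    refine max_le (by positivity) ?_
    linarith [abs_nonneg p.2.2, le_abs_self S]
  · rw [max_eq_left (by linarith [le_abs_self S]), Complex.ofReal_zero]
  · rw [Complex.norm_real, Real.norm_of_nonneg (le_max_left _ _)]
    exact le_max_of_le_right (by linarith)

theorem ofReal_exp_pow_add (lam s t : ℝ) : ((Real.exp (lam * (t + s)) ^ n : ℝ) : ℂ) =
    ((Real.exp (lam * t) ^ n : ℝ) : ℂ) * ((Real.exp (lam * s) ^ n : ℝ) : ℂ) := by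
  rw [← Complex.ofReal_mul, ← mul_pow, ← Real.exp_add, mul_add]

/-- This is the group law `V_t V_s = V_{t+s}` with `u = t + s` substituted, followed by Fubini;
moving `V_t` past `g` dilates the arguments of `g`. -/
theorem rhoOp_mul {f g : Pt n → ℂ} (hf : IsSymbol f) (hg : IsSymbol g) :
    rhoOp lam f * rhoOp lam g = rhoOp lam (twistedConv lam f g) := by
  obtain ⟨C, R, hfb⟩ := hf
  obtain ⟨C', R', hgb⟩ := hg
  have hf : IsSymbol f := ⟨C, R, hfb⟩
  have hg : IsSymbol g := ⟨C', R', hgb⟩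
  -- The cutoff is used only for domination: integrability of the kernel of `χ` at almost every `p`
  -- gives integrability of the weighted orbit of `ζ` on `|u| ≤ R + R'`, the range of `u` where the
  -- product can be nonzero.
  obtain ⟨χ, hχ, hχ1⟩ := exists_symbol_one_le n (R + R')
  refine ContinuousLinearMap.ext fun ζ => Lp.ext ?_
  have hζ := (Lp.stronglyMeasurable ζ).measurable
  rw [mul_apply_eq_comp]
  filter_upwards [rhoOp_apply (lam := lam) hf (rhoOp lam g ζ),
    ae_ae_flow (rhoOp_apply (lam := lam) hg ζ) lam,
    rhoOp_apply (lam := lam) (hf.twistedConv (lam := lam) hg) ζ,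
    ae_integrable_kernelIntegrand (lam := lam) hχ ζ] with p h1 h2 h3 h4
  rw [h1, h3]
  set F : ℝ → ℝ → ℂ := fun t u => ((Real.exp (lam * u) ^ n : ℝ) : ℂ) *
    (f (p.1, p.2.1, t) * g (flow lam t (p.1, p.2.1, u))) * ζ (flow lam u p) with hF
  have hFm : Measurable (Function.uncurry F) := by
    have m1 : Measurable fun z : ℝ × ℝ => f (p.1, p.2.1, z.1) :=
      hfb.continuous.measurable.comp (by fun_prop)
    have m2 : Measurable fun z : ℝ × ℝ => g (flow lam z.1 (p.1, p.2.1, z.2)) :=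
      hgb.continuous.measurable.comp (by unfold flow; fun_prop)
    have m3 : Measurable fun z : ℝ × ℝ => ζ (flow lam z.2 p) :=
      hζ.comp (by unfold flow; fun_prop)
    exact (Measurable.mul (by fun_prop) (m1.mul m2)).mul m3
  have hFi : Integrable (Function.uncurry F) (volume.prod volume) := by
    have hI : Integrable ((Set.Icc (-R) R).indicator fun _ => C * C') volume :=
      (integrable_indicator_iff measurableSet_Icc).2 (integrableOn_const measure_Icc_lt_top.ne)
    -- The dominating function is a product: `C * C'` on `[-R, R]` in `t`, and the norm of the
    -- kernel of `χ` in `u`.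
    refine (hI.mul_prod h4.norm).mono' hFm.aestronglyMeasurable (.of_forall fun z => ?_)
    obtain ⟨t, u⟩ := z
    simp only [Function.uncurry_apply_pair, hF]
    by_cases ht : t ∈ Set.Icc (-R) R
    · rw [Set.indicator_of_mem ht]
      by_cases hu : |u| ≤ R + R'
      · have hχu := hχ1 (p.1, p.2.1, u) hu
        rw [kernelIntegrand, norm_mul, norm_mul, norm_mul, norm_mul, norm_mul]
        have hb : ‖f (p.1, p.2.1, t)‖ * ‖g (flow lam t (p.1, p.2.1, u))‖ ≤ C * C' :=
          mul_le_mul (hfb.norm_le _) (hgb.norm_le _) (norm_nonneg _) hfb.const_nonneg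
        have hb2 : ‖f (p.1, p.2.1, t)‖ * ‖g (flow lam t (p.1, p.2.1, u))‖ ≤
            C * C' * ‖χ (p.1, p.2.1, u)‖ :=
          hb.trans (le_mul_of_one_le_right (mul_nonneg hfb.const_nonneg hgb.const_nonneg) hχu)
        calc _ ≤ ‖((Real.exp (lam * u) ^ n : ℝ) : ℂ)‖ * (C * C' * ‖χ (p.1, p.2.1, u)‖) *
            ‖ζ (flow lam u p)‖ := by gcongr
          _ = _ := by ring
      · have : g (flow lam t (p.1, p.2.1, u)) = 0 := by
          refine hgb.eq_zero _ ?_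
          rw [Set.mem_Icc, ← abs_le] at ht
          have := abs_sub_abs_le_abs_sub u t
          change R' < |u - t|
          linarith
        rw [this, mul_zero, mul_zero, zero_mul, norm_zero]
        exact mul_nonneg (mul_nonneg hfb.const_nonneg hgb.const_nonneg) (norm_nonneg _)
    · rw [Set.indicator_of_notMem ht, zero_mul]
      rw [Set.mem_Icc, ← abs_le, not_le] at ht
      rw [hfb.eq_zero _ ht, zero_mul, mul_zero, zero_mul, norm_zero]
  have e1 : ∫ t, kernelIntegrand lam f (rhoOp lam g ζ) p t = ∫ t, ∫ u, F t u := by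
    refine integral_congr_ae ?_
    filter_upwards [h2] with t ht
    rw [kernelIntegrand, ht, ← integral_const_mul,
      ← integral_add_left_eq_self (μ := volume) (fun u => F t u) t]
    refine integral_congr_ae (.of_forall fun s => ?_)
    simp only [hF, kernelIntegrand, flow_flow, ofReal_exp_pow_add]
    simp only [flow, add_sub_cancel_left]
    ring
  have e2 : ∫ u, kernelIntegrand lam (twistedConv lam f g) ζ p u = ∫ u, ∫ t, F t u := by
    refine integral_congr_ae (.of_forall fun u => ?_)
    simp only [hF, kernelIntegrand, twistedConv]
    rw [← integral_const_mul, ← integral_mul_const]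
  rw [e1, e2, integral_integral_swap hFi]

/-! ### The involution -/

/-- The involutive substitution `(x, y, r) ↦ (e^{λr}x, e^{λr}y, -r)`. -/
def invMap (lam : ℝ) (p : Pt n) : Pt n :=
  (Real.exp (lam * p.2.2) • p.1, Real.exp (lam * p.2.2) • p.2.1, -p.2.2)

theorem continuous_invMap (lam : ℝ) : Continuous (invMap lam : Pt n → Pt n) := by
  unfold invMap
  fun_prop

theorem invMap_invMap (lam : ℝ) (p : Pt n) : invMap lam (invMap lam p) = p := by
  simp [invMap, smul_smul, ← Real.exp_add]

/-- `invMap` as a homeomorphism. -/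
def invHomeo (n : ℕ) (lam : ℝ) : Pt n ≃ₜ Pt n where
  toFun := invMap lam
  invFun := invMap lam
  left_inv := invMap_invMap lam
  right_inv := invMap_invMap lam
  continuous_toFun := continuous_invMap lam
  continuous_invFun := continuous_invMap lam

/-- The involution `f*(x, y, r) = conj f(e^{λr}x, e^{λr}y, -r)` on symbols. -/
def symbolStar (lam : ℝ) (f : Pt n → ℂ) (p : Pt n) : ℂ := star (f (invMap lam p))

theorem IsSymbol.symbolStar {f : Pt n → ℂ} (hf : IsSymbol f) : IsSymbol (symbolStar lam f) := by
  obtain ⟨C, R, hf⟩ := hf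
  refine ⟨C, R, (hf.continuous.comp (continuous_invMap lam)).star, fun p => ?_, hf.nonneg,
    fun p hp => ?_⟩
  · rw [QHeis.symbolStar, norm_star]; exact hf.norm_le _
  · rw [QHeis.symbolStar, hf.eq_zero _ (by simpa [invMap] using hp), star_zero]

theorem hasCompactSupport_symbolStar {f : Pt n → ℂ} (hf : HasCompactSupport f) :
    HasCompactSupport (symbolStar lam f) :=
  (hf.comp_homeomorph (invHomeo n lam)).comp_left (g := star) (star_zero ℂ)

/-- The flow as a homeomorphism. -/
def flowHomeo (n : ℕ) (lam t : ℝ) : Pt n ≃ₜ Pt n where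
  toFun := flow lam t
  invFun := flow lam (-t)
  left_inv p := by rw [flow_flow, add_neg_cancel]; simp [flow]
  right_inv p := by rw [flow_flow, neg_add_cancel]; simp [flow]
  continuous_toFun := by unfold flow; fun_prop
  continuous_invFun := by unfold flow; fun_prop

/-- Going through an equality of measures avoids any integrability assumption on `k`. -/
theorem integral_flow (lam t : ℝ) (k : Pt n → ℂ) :
    (((Real.exp (lam * t) ^ n : ℝ) : ℂ)) ^ 2 * ∫ a : Pt n, k (flow lam t a) = ∫ a, k a := by
  have hm : Measurable (flow lam t : Pt n → Pt n) := (flowHomeo n lam t).continuous.measurable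
  have h1 : ENNReal.ofReal (Real.exp (lam * t) ^ n) ^ 2 •
      Measure.map (flow lam t) (volume : Measure (Pt n)) = volume := by
    refine Measure.ext fun s hs => ?_
    have := lintegral_flow lam t (n := n) (k := s.indicator 1) (measurable_one.indicator hs)
    rw [lintegral_indicator_one hs] at this
    rw [Measure.smul_apply, smul_eq_mul, ← this, Measure.map_apply hm hs]
    congr 1
    exact (lintegral_indicator_one (hm hs)).symm
  conv_rhs => rw [← h1]
  have h2 : ∫ a, k a ∂(Measure.map (flow lam t) volume) = ∫ a : Pt n, k (flow lam t a) :=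
    (flowHomeo n lam t).measurableEmbedding.integral_map k
  rw [integral_smul_measure, h2, ENNReal.toReal_pow, ENNReal.toReal_ofReal (by positivity), Complex.real_smul]
  push_cast
  rfl

/-- Justifies Fubini for matrix coefficients: `∫ ‖kernel‖ dt` is itself in `L²` by the squared
estimate, so its product with `‖ζ'‖` is integrable. -/
theorem integrable_star_mul_kernelIntegrand {f : Pt n → ℂ} (hf : IsSymbol f) (ζ ζ' : Hilb n) :
    Integrable (fun z : Pt n × ℝ => star (ζ' z.1) * kernelIntegrand lam f ζ z.1 z.2)
      (volume.prod volume) := by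
  have hζ := (Lp.stronglyMeasurable ζ).measurable
  have hζ' := (Lp.stronglyMeasurable ζ').measurable
  obtain ⟨C, R, hfb⟩ := hf
  have hm := measurable_kernelIntegrand (lam := lam) hfb.continuous hζ
  have hm' : Measurable fun z : Pt n × ℝ => star (ζ' z.1) :=
    continuous_star.measurable.comp (hζ'.comp measurable_fst)
  refine (integrable_prod_iff (hm'.mul hm).aestronglyMeasurable).2 ⟨?_, ?_⟩
  · filter_upwards [ae_integrable_kernelIntegrand (lam := lam) ⟨C, R, hfb⟩ ζ] with p hp
    exact hp.const_mul (star (ζ' p))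
  · simp only [Pi.mul_apply, norm_mul, norm_star, integral_const_mul]
    refine MemLp.integrable_mul (p := 2) (q := 2) (Lp.memLp ζ').norm
      ⟨hm.norm.stronglyMeasurable.integral_prod_right'.aestronglyMeasurable, ?_⟩
    refine (ENNReal.pow_lt_top_iff (n := 2)).1 ?_ |>.resolve_right two_ne_zero
    rw [eLpNorm_two_sq]
    refine lt_of_le_of_lt (lintegral_mono fun p => ?_)
      ((lintegral_kernelIntegrand_sq_le (lam := lam) hfb hζ).trans_lt ?_)
    · gcongr
      refine (enorm_integral_le_lintegral_enorm _).trans (le_of_eq ?_)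
      simp only [enorm_norm]
    · rw [← eLpNorm_two_sq]
      exact ENNReal.mul_lt_top (by finiteness) (ENNReal.pow_lt_top (Lp.memLp ζ).2)

theorem inner_rhoOp {f : Pt n → ℂ} (hf : IsSymbol f) (ζ ζ' : Hilb n) :
    inner ℂ ζ' (rhoOp lam f ζ) =
      ∫ p : Pt n, ∫ t, star (ζ' p) * kernelIntegrand lam f ζ p t := by
  rw [L2.inner_def]
  refine integral_congr_ae ?_
  filter_upwards [rhoOp_apply (lam := lam) hf ζ] with p hp
  rw [hp, integral_const_mul, RCLike.inner_apply, mul_comm]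
  rfl

/-- Since `V_t` is unitary with inverse `V_{-t}`, the adjoint of `f_t V_t` is `V_{-t}` times the
conjugate of `f_t`; moving the multiplication back to the left and replacing `t` by `-t` gives
`symbolStar`. -/
theorem star_rhoOp {f : Pt n → ℂ} (hf : IsSymbol f) :
    star (rhoOp lam f) = rhoOp lam (symbolStar lam f) := by
  rw [ContinuousLinearMap.star_eq_adjoint, eq_comm, ContinuousLinearMap.eq_adjoint_iff]
  intro ζ' ζ
  rw [inner_rhoOp hf, ← inner_conj_symm, inner_rhoOp hf.symbolStar]
  rw [integral_integral_swap
      (f := fun p t => star (ζ p) * kernelIntegrand lam (symbolStar lam f) ζ' p t)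
      (integrable_star_mul_kernelIntegrand hf.symbolStar ζ' ζ),
    integral_integral_swap (f := fun p t => star (ζ' p) * kernelIntegrand lam f ζ p t)
      (integrable_star_mul_kernelIntegrand hf ζ ζ'),
    ← integral_conj, ← integral_neg_eq_self]
  refine integral_congr_ae (.of_forall fun t => ?_)
  dsimp only
  rw [← integral_conj]
  -- `k` is the pairing, without weight, in the variable `q = flow_t p`. One side is the weight at
  -- `t` times `∫ k ∘ flow_t`, the other the weight at `-t` times `∫ k`; the Jacobian, the square of
  -- the weight, matches them.
  set k : Pt n → ℂ := fun q => star (ζ' (flow lam (-t) q)) *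
    f (Real.exp (lam * -t) • q.1, Real.exp (lam * -t) • q.2.1, t) * ζ q with hk
  have hw : ((Real.exp (lam * t) ^ n : ℝ) : ℂ) * ((Real.exp (lam * -t) ^ n : ℝ) : ℂ) = 1 := by
    rw [← ofReal_exp_pow_add]; simp
  have h1 : ∀ p, star (ζ' p) * kernelIntegrand lam f ζ p t =
      ((Real.exp (lam * t) ^ n : ℝ) : ℂ) * k (flow lam t p) := by
    intro p
    have hp : flow lam (-t) (flow lam t p) = p := (flowHomeo n lam t).left_inv p
    have hp1 := congrArg Prod.fst hp
    have hp2 := congrArg (fun q => q.2.1) hp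
    simp only [hk, hp]
    dsimp only [flow] at hp1 hp2 ⊢
    rw [hp1, hp2]
    simp only [kernelIntegrand, flow]; ring
  have h2 : ∀ q, (starRingEnd ℂ) (star (ζ q) * kernelIntegrand lam (symbolStar lam f) ζ' q (-t)) =
      ((Real.exp (lam * -t) ^ n : ℝ) : ℂ) * k q := by
    intro q
    simp only [kernelIntegrand, symbolStar, hk, invMap, map_mul, Complex.conj_ofReal, neg_neg]
    simp only [Complex.star_def, Complex.conj_conj]
    ring
  simp only [h1, h2]
  rw [integral_const_mul, integral_const_mul, ← integral_flow lam t k, ← mul_assoc, sq,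
    ← mul_assoc, mul_comm ((Real.exp (lam * -t) ^ n : ℝ) : ℂ), hw, one_mul]

/-! ### The algebra of operators with compactly supported symbols -/

/-- Turns uniform approximation of symbols into norm approximation. The radius `R` must be common to
all approximation errors, since the norm bound grows with it. -/
theorem rhoOp_mem_closure {S : Set (Hilb n →L[ℂ] Hilb n)} {f : Pt n → ℂ} {R : ℝ} (hR : 0 ≤ R)
    (hf : Continuous f)
    (h : ∀ ε > 0, ∃ g, IsSymbol g ∧ rhoOp lam g ∈ S ∧ (∀ p, ‖f p - g p‖ ≤ ε) ∧
      ∀ p, R < |p.2.2| → f p = g p) : rhoOp lam f ∈ closure S := by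
  rw [Metric.mem_closure_iff]
  intro ε hε
  -- The denominator `2R + 1` stays positive at `R = 0` and makes `2R · ε/(2R + 1)` strictly less
  -- than `ε`.
  obtain ⟨g, hg, hgS, hfg, h0⟩ := h (ε / (2 * R + 1)) (by positivity)
  refine ⟨_, hgS, ?_⟩
  have hgc : Continuous g := by obtain ⟨_, _, hg⟩ := hg; exact hg.continuous
  have hb : SymbolBound (f - g) (ε / (2 * R + 1)) R :=
    ⟨hf.sub hgc, hfg, hR, fun p hp => by rw [Pi.sub_apply, h0 p hp, sub_self]⟩
  rw [dist_eq_norm]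
  refine (norm_rhoOp_sub_le hg hb).trans_lt ?_
  rw [mul_div_assoc', div_lt_iff₀ (by positivity)]
  nlinarith

/-- The `*`-algebra of the operators `ρ_f`, `f` continuous with compact support. -/
def compactSymbolOps (n : ℕ) (lam : ℝ) : NonUnitalStarSubalgebra ℂ (Hilb n →L[ℂ] Hilb n) where
  carrier := {T | ∃ f : Pt n → ℂ, Continuous f ∧ HasCompactSupport f ∧ rhoOp lam f = T}
  add_mem' := by
    rintro _ _ ⟨f, hf, hfc, rfl⟩ ⟨g, hg, hgc, rfl⟩
    exact ⟨f + g, hf.add hg, hfc.add hgc, rhoOp_add (isSymbol_of_hasCompactSupport hf hfc)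
      (isSymbol_of_hasCompactSupport hg hgc)⟩
  zero_mem' := by
    -- Writing zero as a scalar multiple lets homogeneity give the zero operator.
    refine ⟨(0 : ℂ) • 0, by fun_prop, by rw [zero_smul]; exact HasCompactSupport.zero, ?_⟩
    rw [rhoOp_smul (isSymbol_of_hasCompactSupport continuous_zero HasCompactSupport.zero),
      zero_smul]
  mul_mem' := by
    rintro _ _ ⟨f, hf, hfc, rfl⟩ ⟨g, hg, hgc, rfl⟩
    have hgs := isSymbol_of_hasCompactSupport hg hgc
    have hfs := isSymbol_of_hasCompactSupport hf hfc
    obtain ⟨_, _, hc⟩ := hfs.twistedConv (lam := lam) hgs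
    exact ⟨twistedConv lam f g, hc.continuous, hasCompactSupport_twistedConv hf hfc hgs,
      (rhoOp_mul hfs hgs).symm⟩
  smul_mem' := by
    rintro c _ ⟨f, hf, hfc, rfl⟩
    exact ⟨c • f, hf.const_smul c, hfc.smul_left (f := fun _ => c),
      rhoOp_smul (isSymbol_of_hasCompactSupport hf hfc) c⟩
  star_mem' := by
    rintro _ ⟨f, hf, hfc, rfl⟩
    have hfs := isSymbol_of_hasCompactSupport hf hfc
    obtain ⟨_, _, hc⟩ := hfs.symbolStar (lam := lam)
    exact ⟨symbolStar lam f, hc.continuous, hasCompactSupport_symbolStar hfc,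
      (star_rhoOp hfs).symm⟩

theorem rhoOp_mem_compactSymbolOps {f : Pt n → ℂ} (hf : Continuous f) (hc : HasCompactSupport f) :
    rhoOp lam f ∈ compactSymbolOps n lam := ⟨f, hf, hc, rfl⟩

/-! ### Schwartz symbols and compactly supported symbols have the same closure -/

theorem isSymbol_of_mem_hatA₀ {f : 𝓢(Pt n, ℂ)} (hf : f ∈ hatA₀ n) : IsSymbol (f : Pt n → ℂ) := by
  obtain ⟨K, hK, hfK⟩ := hf
  obtain ⟨R, hR⟩ := hK.isBounded.exists_norm_le
  refine ⟨SchwartzMap.seminorm ℂ 0 0 f, max R 0, f.continuous, f.norm_le_seminorm ℂ,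
    le_max_right _ _, fun p hp => hfK p.1 p.2.1 p.2.2 fun hmem => ?_⟩
  exact absurd hp (not_lt.2 ((hR _ hmem).trans (le_max_left _ _)))

theorem rhoOp_schwartz_mem_closure {f : 𝓢(Pt n, ℂ)} (hf : f ∈ hatA₀ n) :
    rhoOp lam f ∈ closure (compactSymbolOps n lam : Set (Hilb n →L[ℂ] Hilb n)) := by
  obtain ⟨C, R, hfb⟩ := isSymbol_of_mem_hatA₀ hf
  refine rhoOp_mem_closure hfb.nonneg hfb.continuous fun ε hε => ?_
  set D := SchwartzMap.seminorm ℂ 1 0 f with hD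
  have hD0 : 0 ≤ D := apply_nonneg _ _
  -- As `‖p‖ ‖f p‖ ≤ D`, one has `‖f p‖ ≤ ε` beyond radius `D / ε`, so a cutoff equal to `1` up to
  -- that radius changes `f` by at most `ε`.
  set M : ℝ := D / ε with hM
  set χ : Pt n → ℝ := fun p => max 0 (min 1 (M + 1 - ‖p‖)) with hχ
  have hχc : Continuous χ := by fun_prop
  have h0 : ∀ p, 0 ≤ χ p := fun p => le_max_left _ _
  have h1 : ∀ p, χ p ≤ 1 := fun p => max_le zero_le_one (min_le_left _ _)
  have hgc : Continuous fun p => (χ p : ℂ) * f p :=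
    (Complex.continuous_ofReal.comp hχc).mul f.continuous
  have hgs : HasCompactSupport fun p => (χ p : ℂ) * f p := by
    refine HasCompactSupport.intro (isCompact_closedBall 0 (M + 1)) fun p hp => ?_
    have : χ p = 0 := by
      rw [mem_closedBall_zero_iff, not_le] at hp
      exact max_eq_left ((min_le_right _ _).trans (by linarith))
    rw [this, Complex.ofReal_zero, zero_mul]
  refine ⟨_, isSymbol_of_hasCompactSupport hgc hgs, rhoOp_mem_compactSymbolOps hgc hgs,
    fun p => ?_, fun p hp => by rw [hfb.eq_zero p hp, mul_zero]⟩
  rcases le_or_gt ‖p‖ M with hp | hp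
  · have : χ p = 1 := by
      simp only [hχ]
      rw [min_eq_left (by linarith), max_eq_right zero_le_one]
    rw [this, Complex.ofReal_one, one_mul, sub_self, norm_zero]
    exact hε.le
  · have hM0 : 0 ≤ M := by positivity
    have h2 : f p - χ p * f p = ((1 - χ p : ℝ) : ℂ) * f p := by push_cast; ring
    rw [h2, norm_mul, Complex.norm_real, Real.norm_of_nonneg (by linarith [h1 p])]
    have h3 : ‖f p‖ ≤ ε := by
      have h4 := f.norm_pow_mul_le_seminorm ℂ 1 p
      rw [pow_one] at h4
      have h5 : D < ε * ‖p‖ := by rw [hM, div_lt_iff₀ hε] at hp; linarith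
      have h6 : 0 < ‖p‖ := hM0.trans_lt hp
      by_contra h7
      nlinarith
    nlinarith [h0 p, h1 p, norm_nonneg (f p)]

theorem rhoOp_mem_closure_schwartz {f : Pt n → ℂ} (hf : Continuous f) (hc : HasCompactSupport f) :
    rhoOp lam f ∈ closure (Set.range fun g : hatA₀ n => rhoOp lam (g : 𝓢(Pt n, ℂ))) := by
  obtain ⟨C, R, hfb⟩ := isSymbol_of_hasCompactSupport hf hc
  obtain ⟨M, hM⟩ := hc.isCompact.isBounded.exists_norm_le
  refine rhoOp_mem_closure (R := R + 1) (by linarith [hfb.nonneg]) hf fun ε hε => ?_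
  obtain ⟨δ, hδ, hfδ⟩ := Metric.uniformContinuous_iff.1
    (hc.uniformContinuous_of_continuous hf) ε hε
  -- Mollification at scale `min δ 1`: `δ` gives uniform closeness, and the bound `1` keeps the
  -- supports within unit distance.
  obtain ⟨g, hgc, hg⟩ := hf.exists_contDiff_dist_le_of_forall_mem_ball_dist_le
    (lt_min hδ one_pos)
  have hz : ∀ a, (∀ x, dist x a < 1 → f x = 0) → f a = 0 ∧ g a = 0 := by
    intro a ha
    have ha0 : f a = 0 := ha a (by rw [dist_self]; exact one_pos)
    refine ⟨ha0, ?_⟩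
    -- With tolerance `0`, the mollification estimate says that `g` agrees with `f` wherever `f` is
    -- constant on the mollifying ball.
    have := hg a 0 fun x hx => by
      rw [ha x ((Metric.mem_ball.1 hx).trans_le (min_le_right _ _)), ha0, dist_self]
    rwa [ha0, dist_zero_right, norm_le_zero_iff] at this
  have hzr : ∀ p : Pt n, R + 1 < |p.2.2| → f p = 0 ∧ g p = 0 := by
    refine fun p hp => hz p fun x hx => hfb.eq_zero x ?_
    have h1 : |p.2.2 - x.2.2| < 1 := by
      rw [dist_comm, dist_eq_norm] at hx
      exact ((norm_snd_le (p - x).2).trans (norm_snd_le (p - x))).trans_lt hx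
    have h2 := abs_sub_abs_le_abs_sub p.2.2 x.2.2
    linarith
  have hgs : HasCompactSupport g := by
    refine HasCompactSupport.intro (isCompact_closedBall 0 (M + 1)) fun p hp => (hz p fun x hx => ?_).2
    rw [mem_closedBall_zero_iff, not_le] at hp
    by_contra h
    have h1 := hM x (subset_tsupport f h)
    have h2 := norm_sub_norm_le p x
    rw [dist_comm, dist_eq_norm] at hx
    linarith
  have hmem : hgs.toSchwartzMap hgc ∈ hatA₀ n :=
    ⟨Set.Icc (-(R + 1)) (R + 1), isCompact_Icc, fun x y r hr =>
      (hzr (x, y, r) (by rwa [Set.mem_Icc, ← abs_le, not_le] at hr)).2⟩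
  refine ⟨g, isSymbol_of_hasCompactSupport hgc.continuous hgs, ⟨⟨_, hmem⟩, rfl⟩, fun p => ?_,
    fun p hp => by rw [(hzr p hp).1, (hzr p hp).2]⟩
  rw [← dist_eq_norm, dist_comm]
  exact hg p ε fun x hx => (hfδ ((Metric.mem_ball.1 hx).trans_le (min_le_left _ _))).le

theorem closure_range_rhoOp (n : ℕ) (lam : ℝ) :
    closure (Set.range fun g : hatA₀ n => rhoOp lam (g : 𝓢(Pt n, ℂ))) =
      closure (compactSymbolOps n lam : Set (Hilb n →L[ℂ] Hilb n)) := by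
  refine subset_antisymm (closure_minimal ?_ isClosed_closure)
    (closure_minimal ?_ isClosed_closure)
  · rintro _ ⟨g, rfl⟩
    exact rhoOp_schwartz_mem_closure g.2
  · rintro _ ⟨f, hf, hc, rfl⟩
    exact rhoOp_mem_closure_schwartz hf hc

theorem topologicalClosure_adjoin_range_rhoOp (n : ℕ) (lam : ℝ) :
    ((NonUnitalStarAlgebra.adjoin ℂ
      (Set.range fun g : hatA₀ n => rhoOp lam (g : 𝓢(Pt n, ℂ)))).topologicalClosure :
        Set (Hilb n →L[ℂ] Hilb n)) =
      closure (compactSymbolOps n lam : Set (Hilb n →L[ℂ] Hilb n)) := by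
  refine subset_antisymm ?_ ?_
  · have h : NonUnitalStarAlgebra.adjoin ℂ
        (Set.range fun g : hatA₀ n => rhoOp lam (g : 𝓢(Pt n, ℂ))) ≤
        (compactSymbolOps n lam).topologicalClosure := by
      refine NonUnitalStarAlgebra.adjoin_le ?_
      rintro _ ⟨g, rfl⟩
      exact rhoOp_schwartz_mem_closure g.2
    exact NonUnitalStarSubalgebra.topologicalClosure_minimal _ h
      (NonUnitalStarSubalgebra.isClosed_topologicalClosure _)
  · rw [← closure_range_rhoOp]
    exact closure_mono (NonUnitalStarAlgebra.subset_adjoin ℂ _)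

/-! ### Slices of `U_A` by vector functionals -/

/-- The slice `(id ⊗ ω_{ξ,η})(U_A)` by the vector functional `T ↦ ⟨T ξ, η⟩`. -/
def vecSlice (lam : ℝ) (ξ η : Hilb n) : Hilb n →L[ℂ] Hilb n :=
  (ContinuousLinearMap.adjoint ((tensor volume volume).flip η)) ∘L UA n lam ∘L
    ((tensor volume volume).flip ξ)

theorem inner_vecSlice (ξ η ζ ζ' : Hilb n) : inner ℂ ζ' (vecSlice lam ξ η ζ) =
    inner ℂ (tensor volume volume ζ' η) (UA n lam (tensor volume volume ζ ξ)) := by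
  simp [vecSlice, ContinuousLinearMap.adjoint_inner_right]

theorem continuous_vecSlice (n : ℕ) (lam : ℝ) :
    Continuous fun z : Hilb n × Hilb n => vecSlice lam z.1 z.2 := by
  unfold vecSlice
  refine Continuous.clm_comp ?_ (Continuous.clm_comp continuous_const ?_)
  · exact ContinuousLinearMap.adjoint.continuous.comp
      ((ContinuousLinearMap.continuous _).comp continuous_snd)
  · exact (ContinuousLinearMap.continuous _).comp continuous_fst

/-- The bound by a sum of squares is the form that matches the summability conditions in `predual`.
-/
theorem exists_norm_vecSlice_le (n : ℕ) (lam : ℝ) :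
    ∃ K : ℝ, ∀ ξ η : Hilb n, ‖vecSlice lam ξ η‖ ≤ K * (‖ξ‖ ^ 2 + ‖η‖ ^ 2) := by
  set A := ‖((tensor (volume : Measure (Pt n)) (volume : Measure (Pt n))).flip)‖ with hA
  have hA0 : 0 ≤ A := hA ▸ norm_nonneg (tensor (volume : Measure (Pt n)) (volume : Measure (Pt n))).flip
  refine ⟨A * ‖UA n lam‖ * A, fun ξ η => ?_⟩
  have h1 : ‖vecSlice lam ξ η‖ ≤ (A * ‖η‖) * (‖UA n lam‖ * (A * ‖ξ‖)) := by
    refine (ContinuousLinearMap.opNorm_comp_le _ _).trans ?_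
    have h2 : ‖(UA n lam) ∘L ((tensor volume volume).flip ξ)‖ ≤ ‖UA n lam‖ * (A * ‖ξ‖) :=
      (ContinuousLinearMap.opNorm_comp_le _ _).trans
        (by gcongr; exact ContinuousLinearMap.le_opNorm _ ξ)
    rw [LinearIsometryEquiv.norm_map]
    have h3 := ContinuousLinearMap.le_opNorm
      ((tensor (volume : Measure (Pt n)) (volume : Measure (Pt n))).flip) η
    gcongr
  calc _ ≤ A * ‖UA n lam‖ * A * (‖ξ‖ * ‖η‖) := h1.trans (le_of_eq (by ring))
    _ ≤ _ := by
      gcongr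
      nlinarith [sq_nonneg (‖ξ‖ - ‖η‖), sq_nonneg ‖ξ‖, sq_nonneg ‖η‖]

/-- The series of slices converges absolutely in norm; comparing matrix coefficients, where the
series for `ω` is applied to `vectorSlice`, identifies its sum. -/
theorem hasSum_vecSlice {ω : StrongDual ℂ (Hilb n →L[ℂ] Hilb n)} {ξ η : ℕ → Hilb n}
    (hξ : Summable fun k => ‖ξ k‖ ^ 2) (hη : Summable fun k => ‖η k‖ ^ 2)
    (hω : ∀ T : Hilb n →L[ℂ] Hilb n, HasSum (fun k => inner ℂ (η k) (T (ξ k))) (ω T)) :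
    HasSum (fun k => vecSlice lam (ξ k) (η k)) (rightSlice ω (UA n lam)) := by
  obtain ⟨K, hK⟩ := exists_norm_vecSlice_le n lam
  have hs : Summable fun k => vecSlice lam (ξ k) (η k) :=
    Summable.of_norm_bounded ((hξ.add hη).mul_left K) fun k => hK _ _
  have h : rightSlice ω (UA n lam) = ∑' k, vecSlice lam (ξ k) (η k) := by
    refine ContinuousLinearMap.ext fun ζ => ext_inner_left ℂ fun ζ' => ?_
    have h1 := hs.hasSum.mapL ((innerSL ℂ ζ') ∘L (ContinuousLinearMap.apply ℂ (Hilb n) ζ))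
    have h2 := hω (vectorSlice (UA n lam) ζ ζ')
    rw [inner_rightSlice]
    have h3 : HasSum (fun k => inner ℂ ζ' (vecSlice lam (ξ k) (η k) ζ))
        (inner ℂ ζ' ((∑' k, vecSlice lam (ξ k) (η k)) ζ)) := h1
    simp only [inner_vecSlice] at h3
    simp only [inner_vectorSlice] at h2
    exact h2.unique h3
  rw [h]
  exact hs.hasSum

theorem vecSlice_mem_hatA (ξ η : Hilb n) : vecSlice lam ξ η ∈ hatA n lam := by
  refine subset_closure ⟨(innerSL ℂ η) ∘L (ContinuousLinearMap.apply ℂ (Hilb n) ξ), ?_, ?_⟩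
  · refine ⟨Pi.single 0 ξ, Pi.single 0 η, ?_, ?_, fun T => ?_⟩
    · refine summable_of_ne_finset_zero (s := {0}) fun k hk => ?_
      simp [Pi.single_eq_of_ne (Finset.notMem_singleton.1 hk)]
    · refine summable_of_ne_finset_zero (s := {0}) fun k hk => ?_
      simp [Pi.single_eq_of_ne (Finset.notMem_singleton.1 hk)]
    · have := hasSum_single (f := fun k => inner ℂ ((Pi.single 0 η : ℕ → Hilb n) k)
        (T ((Pi.single 0 ξ : ℕ → Hilb n) k))) 0 fun k hk => by simp [Pi.single_eq_of_ne hk]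
      simpa using this
  · refine ContinuousLinearMap.ext fun ζ => ext_inner_left ℂ fun ζ' => ?_
    rw [inner_rightSlice, inner_vecSlice]
    simp [inner_vectorSlice]

/-! ### The symbol of a slice -/

theorem continuous_eta (lam : ℝ) : Continuous (eta lam) := by
  unfold eta
  split_ifs <;> fun_prop

theorem continuous_ebar : Continuous ebar := by
  unfold ebar
  fun_prop

/-- The integrand of `sliceFun`. -/
def sliceIntegrand (lam : ℝ) (ξ η : Pt n → ℂ) (p : Pt n) (a : E n × E n) : ℂ :=
  star (η (a.1, a.2, p.2.2)) * ebar (eta lam p.2.2 * inner ℝ p.1 (a.2 - p.2.1)) *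
    ξ (a.1 - p.1, a.2 - p.2.1, p.2.2)

/-- The symbol of the slice of `U_A` by `ω_{ξ,η}`, up to the substitution `invMap`. -/
def sliceFun (lam : ℝ) (ξ η : Pt n → ℂ) (p : Pt n) : ℂ := ∫ a, sliceIntegrand lam ξ η p a

theorem continuous_sliceIntegrand {ξ η : Pt n → ℂ} (hξ : Continuous ξ) (hη : Continuous η) :
    Continuous fun z : Pt n × (E n × E n) => sliceIntegrand lam ξ η z.1 z.2 := by
  unfold sliceIntegrand
  have := continuous_eta lam
  have := continuous_ebar
  fun_prop

/-- For every `p` the integrand vanishes off the projection of the support of `η`, so the integral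
is over a fixed compact set. -/
theorem continuous_sliceFun {ξ η : Pt n → ℂ} (hξ : Continuous ξ) (hη : Continuous η)
    (hηc : HasCompactSupport η) : Continuous (sliceFun lam ξ η) := by
  have hK : IsCompact ((fun p : Pt n => (p.1, p.2.1)) '' tsupport η) :=
    hηc.isCompact.image (by fun_prop)
  have h : sliceFun lam ξ η = fun p =>
      ∫ a in (fun p : Pt n => (p.1, p.2.1)) '' tsupport η, sliceIntegrand lam ξ η p a := by
    refine funext fun p => (setIntegral_eq_integral_of_forall_compl_eq_zero fun a ha => ?_).symm
    have : η (a.1, a.2, p.2.2) = 0 := by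
      by_contra h
      exact ha ⟨_, subset_tsupport η h, rfl⟩
    rw [sliceIntegrand, this, star_zero, zero_mul, zero_mul]
  rw [h]
  exact continuous_parametric_integral_of_continuous (continuous_sliceIntegrand hξ hη) hK

theorem hasCompactSupport_sliceFun {ξ η : Pt n → ℂ} (hξc : HasCompactSupport ξ)
    (hηc : HasCompactSupport η) : HasCompactSupport (sliceFun lam ξ η) := by
  obtain ⟨M, hM⟩ := hξc.isCompact.isBounded.exists_norm_le
  obtain ⟨M', hM'⟩ := hηc.isCompact.isBounded.exists_norm_le
  refine HasCompactSupport.intro (isCompact_closedBall 0 (M + M')) fun p hp => ?_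
  rw [sliceFun]
  refine integral_eq_zero_of_ae (.of_forall fun a => ?_)
  by_contra h
  refine hp ?_
  simp only [sliceIntegrand, Pi.zero_apply, mul_eq_zero, star_eq_zero, not_or] at h
  have h1 := hM' _ (subset_tsupport η h.1.1)
  have h2 := hM _ (subset_tsupport ξ h.2)
  simp only [Prod.norm_def, max_le_iff] at h1 h2
  rw [mem_closedBall_zero_iff, Prod.norm_def, Prod.norm_def, max_le_iff, max_le_iff]
  have h3 := norm_sub_norm_le p.1 a.1
  have h4 := norm_sub_norm_le p.2.1 a.2
  rw [norm_sub_rev] at h3 h4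
  have h5 := norm_nonneg p.2.2
  exact ⟨by linarith [h1.1, h2.1], by linarith [h1.2.1, h2.2.1], by linarith [h1.2.2, h2.2.2]⟩

theorem integral_pt {k : Pt n → ℂ} (hk : Integrable k) :
    ∫ q, k q = ∫ r : ℝ, ∫ a : E n × E n, k (a.1, a.2, r) := by
  have hp : MeasurePreserving (MeasurableEquiv.prodAssoc : (E n × E n) × ℝ ≃ᵐ Pt n)
      ((volume.prod volume).prod volume) volume :=
    measurePreserving_prodAssoc volume volume volume
  rw [← hp.integral_comp']
  exact integral_prod_symm _ ((hp.integrable_comp_emb (MeasurableEquiv.measurableEmbedding _)).2 hk)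

theorem inner_tensor_UA_tensor_ae {ξ η : Pt n → ℂ} {ξ' η' : Hilb n} (ζ ζ' : Hilb n)
    (hξ' : ξ' =ᵐ[volume] ξ) (hη' : η' =ᵐ[volume] η) :
    ∀ᵐ z ∂((volume : Measure (Pt n)).prod (volume : Measure (Pt n))),
      inner ℂ (tensor volume volume ζ' η' z) (UA n lam (tensor volume volume ζ ξ') z) =
        star (ζ' z.1 * η z.2) *
          (uWeight n lam z * (ζ (uMap n lam z).1 * ξ (uMap n lam z).2)) := by
  have hq := (isWeightedIso_u n lam).quasi
  have e1 := tensor_apply volume volume ζ' η'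
  have e2 := UA_apply n lam (tensor volume volume ζ ξ')
  have e3 : ∀ᵐ z ∂((volume : Measure (Pt n)).prod (volume : Measure (Pt n))),
      tensor volume volume ζ ξ' (uMap n lam z) = ζ (uMap n lam z).1 * ξ' (uMap n lam z).2 :=
    hq.ae (tensor_apply volume volume ζ ξ')
  have e4 : ∀ᵐ z ∂((volume : Measure (Pt n)).prod (volume : Measure (Pt n))),
      ξ' (uMap n lam z).2 = ξ (uMap n lam z).2 :=
    hq.ae (Measure.quasiMeasurePreserving_snd.ae hξ')
  have e5 : ∀ᵐ z ∂((volume : Measure (Pt n)).prod (volume : Measure (Pt n))),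
      η' z.2 = η z.2 := Measure.quasiMeasurePreserving_snd.ae hη'
  filter_upwards [e1, e2, e3, e4, e5] with z h1 h2 h3 h4 h5
  generalize (tensor volume volume ζ' η' : Pt n × Pt n → ℂ) z = A at h1 ⊢
  generalize (UA n lam (tensor volume volume ζ ξ') : Pt n × Pt n → ℂ) z = B at h2 ⊢
  rw [RCLike.inner_apply, h1, h2, h3, h4, h5, mul_comm]
  rfl

/-- In the matrix coefficient, fix `(x, y, r)` and set `r' = -t`. The modulus of the weight and the
first component of `uMap` become the weight and flow of `ρ`; what depends on `(x', y')` integrates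
to `sliceFun` at `invMap (x, y, t)`. -/
theorem vecSlice_eq_rhoOp {ξ η : Pt n → ℂ} (hξ : Continuous ξ) (hξc : HasCompactSupport ξ)
    (hη : Continuous η) (hηc : HasCompactSupport η)
    {ξ' η' : Hilb n} (hξ' : ξ' =ᵐ[volume] ξ) (hη' : η' =ᵐ[volume] η) :
    vecSlice lam ξ' η' = rhoOp lam (sliceFun lam ξ η ∘ invMap lam) := by
  have hs : IsSymbol (sliceFun lam ξ η ∘ invMap lam) := isSymbol_of_hasCompactSupport
    ((continuous_sliceFun hξ hη hηc).comp (continuous_invMap lam))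
    ((hasCompactSupport_sliceFun hξc hηc).comp_homeomorph (invHomeo n lam))
  refine ContinuousLinearMap.ext fun ζ => ext_inner_left ℂ fun ζ' => ?_
  rw [inner_vecSlice, inner_rhoOp hs]
  set G : Pt n × Pt n → ℂ := fun z => star (ζ' z.1 * η z.2) *
    (uWeight n lam z * (ζ (uMap n lam z).1 * ξ (uMap n lam z).2)) with hG
  have hGae := inner_tensor_UA_tensor_ae (lam := lam) ζ ζ' hξ' hη'
  have hGi : Integrable G (volume.prod volume) := (L2.integrable_inner _ _).congr hGae
  rw [L2.inner_def, integral_congr_ae hGae, integral_prod _ hGi]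
  refine integral_congr_ae ?_
  filter_upwards [hGi.prod_right_ae] with p hp
  rw [integral_pt hp, ← integral_neg_eq_self]
  refine integral_congr_ae (.of_forall fun t => ?_)
  simp only [kernelIntegrand, Function.comp_apply, sliceFun]
  rw [← integral_const_mul, ← integral_mul_const, ← integral_const_mul]
  refine integral_congr_ae (.of_forall fun a => ?_)
  simp only [hG, uWeight, uMap, sliceIntegrand, invMap, flow, neg_mul_neg, star_mul',
    sub_eq_add_neg]
  ring

/-! ### General slices as limits of slices by compactly supported functions -/

theorem mem_closure_hasCompactSupport (ξ : Hilb n) :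
    ξ ∈ closure {ξ' : Hilb n | ∃ (g : Pt n → ℂ) (hg : MemLp g 2 volume), Continuous g ∧
      HasCompactSupport g ∧ ξ' = hg.toLp} := by
  rw [EMetric.mem_closure_iff]
  intro ε hε
  obtain ⟨g, hgc, hg, hgcont, hgm⟩ := (Lp.memLp ξ).exists_hasCompactSupport_eLpNorm_sub_le
    (by simp) (ENNReal.half_pos hε.ne').ne'
  refine ⟨_, ⟨g, hgm, hgcont, hgc, rfl⟩, ?_⟩
  have h1 : edist ξ (hgm.toLp g) = eLpNorm ((ξ : Pt n → ℂ) - g) 2 volume := by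
    conv_lhs => rw [← Lp.toLp_coeFn ξ (Lp.memLp ξ)]
    rw [Lp.edist_toLp_toLp]
  rw [h1]
  -- Half of `∞` is not smaller than `∞`, so that radius is treated apart.
  rcases eq_or_ne ε ∞ with rfl | hε'
  · rw [← h1]; exact edist_lt_top _ _
  · exact hg.trans_lt (ENNReal.half_lt_self hε.ne' hε')

theorem vecSlice_mem_closure (ξ η : Hilb n) :
    vecSlice lam ξ η ∈ closure (compactSymbolOps n lam : Set (Hilb n →L[ℂ] Hilb n)) := by
  refine map_mem_closure₂ (f := vecSlice lam) (continuous_vecSlice n lam)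
    (mem_closure_hasCompactSupport ξ)
    (mem_closure_hasCompactSupport η) ?_
  rintro _ ⟨f, hfm, hf, hfc, rfl⟩ _ ⟨g, hgm, hg, hgc, rfl⟩
  rw [vecSlice_eq_rhoOp hf hfc hg hgc hfm.coeFn_toLp hgm.coeFn_toLp]
  exact rhoOp_mem_compactSymbolOps
    ((continuous_sliceFun hf hg hgc).comp (continuous_invMap lam))
    ((hasCompactSupport_sliceFun hfc hgc).comp_homeomorph (invHomeo n lam))

theorem hatA_subset (n : ℕ) (lam : ℝ) :
    hatA n lam ⊆ closure (compactSymbolOps n lam : Set (Hilb n →L[ℂ] Hilb n)) := by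
  refine closure_minimal ?_ isClosed_closure
  rintro _ ⟨ω, ⟨ξ, η, hξ, hη, hω⟩, rfl⟩
  refine isClosed_closure.mem_of_tendsto (hasSum_vecSlice hξ hη hω) (.of_forall fun s => ?_)
  have h : ∀ k ∈ s, vecSlice lam (ξ k) (η k) ∈ (compactSymbolOps n lam).topologicalClosure :=
    fun k _ => vecSlice_mem_closure (ξ k) (η k)
  exact sum_mem h

/-! ### Approximation of symbols by symbols of slices -/

/-- With `η` the conjugate of `h` and `ξ` a bump `ψ` in `(x, y)` times a cutoff in `r`, translating
the variable turns `sliceFun` into an average of `h(x + a₁, y + a₂, r)` times a phase over small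
`a`. The phase equals `1` at `a = 0`, so the average tends to `h`, uniformly by compactness. -/
theorem exists_sliceFun_approx {h : Pt n → ℂ} (hh : Continuous h) (hc : HasCompactSupport h)
    {ε : ℝ} (hε : 0 < ε) :
    ∃ ξ : Pt n → ℂ, Continuous ξ ∧ HasCompactSupport ξ ∧
      ∀ p, ‖h p - sliceFun lam ξ (fun q => star (h q)) p‖ ≤ ε := by
  obtain ⟨M, hM⟩ := hc.isCompact.isBounded.exists_norm_le
  have hz : ∀ p : Pt n, h p ≠ 0 → ‖p‖ ≤ M := fun p hp => hM p (subset_tsupport h hp)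
  -- The cutoff in `a` is `1` for `‖a‖ ≤ 1`, where the bump lives. It gives `H` compact support,
  -- hence uniform continuity, although the phase alone is not uniformly continuous in general.
  set H : Pt n × (E n × E n) → ℂ := fun z => ((max 0 (min 1 (2 - ‖z.2‖)) : ℝ) : ℂ) *
    (h (z.1.1 + z.2.1, z.1.2.1 + z.2.2, z.1.2.2) *
      ebar (eta lam z.1.2.2 * inner ℝ z.1.1 z.2.2)) with hH
  have hHc : Continuous H := by
    have := continuous_eta lam
    have := continuous_ebar
    fun_prop
  have hHs : HasCompactSupport H := by
    refine HasCompactSupport.intro (isCompact_closedBall 0 (M + 2) |>.prod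
      (isCompact_closedBall 0 2)) fun z hzn => ?_
    by_contra hne
    refine hzn ?_
    simp only [hH, mul_eq_zero, not_or] at hne
    have h2 : ‖z.2‖ ≤ 2 := by
      by_contra h2
      exact hne.1 (by
        rw [max_eq_left ((min_le_right _ _).trans (by linarith)), Complex.ofReal_zero])
    have h1 := hz _ hne.2.1
    simp only [Prod.norm_def, max_le_iff] at h1
    have h3 := norm_sub_norm_le z.1.1 (-z.2.1)
    have h4 := norm_sub_norm_le z.1.2.1 (-z.2.2)
    rw [sub_neg_eq_add, norm_neg] at h3 h4
    have h5 := norm_fst_le z.2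
    have h6 := norm_snd_le z.2
    refine ⟨mem_closedBall_zero_iff.2 ?_, mem_closedBall_zero_iff.2 h2⟩
    rw [Prod.norm_def, Prod.norm_def, max_le_iff, max_le_iff]
    exact ⟨by linarith [h1.1], by linarith [h1.2.1], by linarith [h1.2.2]⟩
  obtain ⟨δ, hδ, hHδ⟩ := Metric.uniformContinuous_iff.1 (hHs.uniformContinuous_of_continuous hHc)
    ε hε
  have hδ1 : 0 < min δ 1 := lt_min hδ one_pos
  set φ : ContDiffBump (0 : E n × E n) :=
    ⟨min δ 1 / 2, min δ 1, half_pos hδ1, half_lt_self hδ1⟩ with hφ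
  set ψ : E n × E n → ℝ := φ.normed volume with hψ
  have hψc : Continuous ψ := φ.continuous_normed
  have hψs : HasCompactSupport ψ := φ.hasCompactSupport_normed
  have hψ0 : ∀ a, 0 ≤ ψ a := φ.nonneg_normed
  have hψ1 : ∫ a, ψ a = 1 := φ.integral_normed
  have hψz : ∀ a, ψ a ≠ 0 → ‖a‖ < min δ 1 := fun a ha => by
    have : a ∈ Function.support ψ := ha
    rw [hψ, φ.support_normed_eq] at this
    simpa [hφ] using this
  -- Equal to `1` for `|s| ≤ M`, hence at every `r` met by the support of `h`: it makes `ξ`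
  -- compactly supported without affecting the average.
  set χ : ℝ → ℝ := fun s => max 0 (min 1 (M + 1 - |s|)) with hχ
  have hξc : Continuous fun q : Pt n => ((ψ (q.1, q.2.1) * χ q.2.2 : ℝ) : ℂ) := by
    fun_prop
  refine ⟨_, hξc, ?_, fun p => ?_⟩
  · refine HasCompactSupport.intro (isCompact_closedBall 0 (max 1 (M + 1))) fun q hq => ?_
    by_contra hne
    refine hq ?_
    simp only [Complex.ofReal_eq_zero, mul_eq_zero, not_or] at hne
    have h1 := (hψz _ hne.1).le.trans (min_le_right _ _)
    have h2 : |q.2.2| ≤ M + 1 := by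
      by_contra h2
      exact hne.2 (max_eq_left ((min_le_right _ _).trans (by linarith)))
    rw [Prod.norm_def, max_le_iff] at h1
    rw [mem_closedBall_zero_iff, Prod.norm_def, Prod.norm_def, max_le_iff, max_le_iff]
    exact ⟨h1.1.trans (le_max_left _ _), h1.2.trans (le_max_left _ _), h2.trans (le_max_right _ _)⟩
  · set F : E n × E n → ℂ := fun a => (ψ a : ℂ) * (χ p.2.2 *
      (h (p.1 + a.1, p.2.1 + a.2, p.2.2) * ebar (eta lam p.2.2 * inner ℝ p.1 a.2))) with hF
    have e1 : sliceFun lam (fun q : Pt n => ((ψ (q.1, q.2.1) * χ q.2.2 : ℝ) : ℂ))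
        (fun q => star (h q)) p = ∫ a, F a := by
      have : (volume : Measure (E n × E n)).IsAddLeftInvariant :=
        inferInstanceAs ((volume : Measure (E n)).prod volume).IsAddLeftInvariant
      rw [sliceFun, ← integral_add_left_eq_self (μ := volume) _ ((p.1, p.2.1) : E n × E n)]
      refine integral_congr_ae (.of_forall fun a => ?_)
      simp only [sliceIntegrand, hF, Prod.fst_add, Prod.snd_add, star_star, add_sub_cancel_left,
        Complex.ofReal_mul]
      ring
    have e2 : h p = ∫ a, (ψ a : ℂ) * h p := by
      rw [integral_mul_const, integral_complex_ofReal, hψ1, Complex.ofReal_one, one_mul]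
    have hψi : Integrable fun a => (ψ a : ℂ) :=
      (hψc.integrable_of_hasCompactSupport hψs).ofReal
    have hFi : Integrable F := by
      refine Continuous.integrable_of_hasCompactSupport ?_ ?_
      · have := continuous_ebar
        fun_prop
      · exact (hψs.comp_left (g := fun x : ℝ => (x : ℂ)) Complex.ofReal_zero).mul_right
    rw [e1]
    conv_lhs => rw [e2]
    rw [← integral_sub (hψi.mul_const _) hFi]
    have e3 : ε = ∫ a, ψ a * ε := by rw [integral_mul_const, hψ1, one_mul]
    rw [e3]
    refine norm_integral_le_of_norm_le
      ((hψc.integrable_of_hasCompactSupport hψs).mul_const _) (.of_forall fun a => ?_)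
    rw [hF, ← mul_sub, norm_mul, Complex.norm_real, Real.norm_of_nonneg (hψ0 a)]
    by_cases ha : ψ a = 0
    · simp [ha]
    refine mul_le_mul_of_nonneg_left ?_ (hψ0 a)
    rcases le_or_gt |p.2.2| M with hp | hp
    · have hχ1 : χ p.2.2 = 1 := by
        simp only [hχ]
        rw [min_eq_left (by linarith), max_eq_right zero_le_one]
      rw [hχ1, Complex.ofReal_one, one_mul]
      have ha1 := hψz a ha
      have h1 := ha1.trans_le (min_le_right δ 1)
      have h2 : dist ((p, 0) : Pt n × (E n × E n)) (p, a) < δ := by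
        rw [Prod.dist_eq, dist_self, dist_zero_left, max_eq_right (norm_nonneg _)]
        exact ha1.trans_le (min_le_left _ _)
      have h3 : H (p, 0) = h p := by
        simp [hH, ebar]
      have h4 : H (p, a) = h (p.1 + a.1, p.2.1 + a.2, p.2.2) *
          ebar (eta lam p.2.2 * inner ℝ p.1 a.2) := by
        simp only [hH]
        rw [min_eq_left (by linarith), max_eq_right zero_le_one, Complex.ofReal_one, one_mul]
      have h5 := (hHδ h2).le
      rwa [dist_eq_norm, h3, h4] at h5
    -- Beyond `M` both `h p` and the averaged values vanish, whatever the cutoff.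
    · have hz' : ∀ x y, h (x, y, p.2.2) = 0 := fun x y => by
        by_contra hne
        have := hz _ hne
        simp only [Prod.norm_def, max_le_iff] at this
        exact absurd this.2.2 (not_le.2 hp)
      rw [show h p = 0 from hz' p.1 p.2.1, hz']
      simpa using hε.le

/-- The symbol of a slice is `sliceFun` composed with `invMap`, so the approximation is made for `f
∘ invMap` and undone by the involution. Since `invMap` only changes the sign of `r`, and `η`
vanishes wherever `f ∘ invMap` does, the error keeps the `r`-support of `f`. -/
theorem rhoOp_mem_hatA {f : Pt n → ℂ} (hf : Continuous f) (hc : HasCompactSupport f) :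
    rhoOp lam f ∈ hatA n lam := by
  have hh : Continuous (f ∘ invMap lam) := hf.comp (continuous_invMap lam)
  have hhc : HasCompactSupport (f ∘ invMap lam) := hc.comp_homeomorph (invHomeo n lam)
  obtain ⟨C, R, hfb⟩ := isSymbol_of_hasCompactSupport hf hc
  rw [← IsClosed.closure_eq (s := hatA n lam) isClosed_closure]
  refine rhoOp_mem_closure hfb.nonneg hf fun ε hε => ?_
  obtain ⟨ξ, hξ, hξc, hle⟩ := exists_sliceFun_approx (lam := lam) hh hhc hε
  set η : Pt n → ℂ := fun q => star ((f ∘ invMap lam) q) with hη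
  have hηcont : Continuous η := hh.star
  have hηc : HasCompactSupport η := hhc.comp_left (g := star) (star_zero ℂ)
  have hξm : MemLp ξ 2 (volume : Measure (Pt n)) := hξ.memLp_of_hasCompactSupport hξc
  have hηm : MemLp η 2 (volume : Measure (Pt n)) := hηcont.memLp_of_hasCompactSupport hηc
  refine ⟨sliceFun lam ξ η ∘ invMap lam, isSymbol_of_hasCompactSupport
    ((continuous_sliceFun hξ hηcont hηc).comp (continuous_invMap lam))
    ((hasCompactSupport_sliceFun hξc hηc).comp_homeomorph (invHomeo n lam)), ?_, fun p => ?_,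
    fun p hp => ?_⟩
  · rw [← vecSlice_eq_rhoOp hξ hξc hηcont hηc hξm.coeFn_toLp hηm.coeFn_toLp]
    exact vecSlice_mem_hatA _ _
  · have := hle (invMap lam p)
    rwa [Function.comp_apply, invMap_invMap] at this
  · rw [hfb.eq_zero p hp, Function.comp_apply, sliceFun]
    refine (integral_eq_zero_of_ae (.of_forall fun a => ?_)).symm
    have h0 : η (a.1, a.2, (invMap lam p).2.2) = 0 := by
      simp only [hη, Function.comp_apply, star_eq_zero]
      exact hfb.eq_zero _ (by simpa [invMap] using hp)
    simp [sliceIntegrand, h0]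

theorem hatA_eq (n : ℕ) (lam : ℝ) :
    hatA n lam = closure (compactSymbolOps n lam : Set (Hilb n →L[ℂ] Hilb n)) := by
  refine subset_antisymm (hatA_subset n lam) (closure_minimal ?_ isClosed_closure)
  rintro _ ⟨f, hf, hc, rfl⟩
  exact rhoOp_mem_hatA hf hc

end QHeis

end

theorem mainTheorem7 (n : ℕ) (lam : ℝ) :
    ∃ ρ : QHeis.hatA₀ n → (QHeis.Hilb n →L[ℂ] QHeis.Hilb n),
      (∀ (f : QHeis.hatA₀ n) (ζ : QHeis.Hilb n), ∀ᵐ p : QHeis.Pt n,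
        Integrable (QHeis.rhoIntegrand n lam f ζ p) ∧
          ρ f ζ p = ∫ t : ℝ, QHeis.rhoIntegrand n lam f ζ p t) ∧
      closure (Set.range ρ) = QHeis.hatA n lam ∧
      ((NonUnitalStarAlgebra.adjoin ℂ (Set.range ρ)).topologicalClosure :
        Set (QHeis.Hilb n →L[ℂ] QHeis.Hilb n)) = QHeis.hatA n lam := by
  refine ⟨fun f => QHeis.rhoOp lam (f : 𝓢(QHeis.Pt n, ℂ)), fun f ζ => ?_, ?_, ?_⟩
  · have hf := QHeis.isSymbol_of_mem_hatA₀ f.2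
    filter_upwards [QHeis.ae_integrable_kernelIntegrand (lam := lam) hf ζ,
      QHeis.rhoOp_apply (lam := lam) hf ζ] with p h1 h2
    exact ⟨h1, h2⟩
  · rw [QHeis.closure_range_rhoOp, QHeis.hatA_eq]
  · rw [QHeis.topologicalClosure_adjoin_range_rhoOp, QHeis.hatA_eq]
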